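/- Let $K$ be a field, $m\ge 1$, and $\mathbf q=(q_0,\dots,q_{m-1})\in(K^*)^m$; all vertex labels and the subscripts of $q$, $e$, $a$, $\bar a$ are taken modulo $m$. Let $\mathcal Q$ be the quiver with vertices $0,\dots,m-1$ and, for each $i$, arrows $a_i:i\to i+1$ and $\bar a_i:i+1\to i$. Let $e_i$ be the trivial path at $i$; paths are written from left to right. Let $\Lambda_{\mathbf q}=K\mathcal Q/I_{\mathbf q}$, where $I_{\mathbf q}$ is the two-sided ideal generated by $a_ia_{i+1}$, $\bar a_{i-1}\bar a_{i-2}$ and $q_ia_i\bar a_i-\bar a_{i-1}a_{i-1}$ for all $i$. For $n\ge 0$, $0\le r\le n$ and a vertex $i$, define $g^n_{r,i}\in K\mathcal Q$ by $g^0_{0,i}=e_i$ and, for $n\ge1$, $$g^n_{r,i}=g^{n-1}_{r,i}\,a_{i+n-2r-1}+(-1)^n\Big(\prod_{j=1}^{n-r}q_{i-r+j}\Big)\,g^{n-1}_{r-1,i}\,\bar a_{i+n-2r},$$ where $g^{n-1}_{-1,i}=g^{n-1}_{n,i}=0$ and empty products are $1$. Let $$P^n=\bigoplus_{i=0}^{m-1}\bigoplus_{r=0}^{n}\Lambda_{\mathbf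 q}e_i\otimes_K e_{i+n-2r}\Lambda_{\mathbf q},$$ and write $x\otimes_r y$ with $x\in\Lambda_{\mathbf q}e_i$, $y\in e_{i+n-2r}\Lambda_{\mathbf q}$ for an element of the summand of $P^n$ with indices $(i,r)$, labelled by $g^n_{r,i}$; terms $\otimes_r$ with $r<0$ or $r>n$ are zero. Let $\partial^0:P^0\to\Lambda_{\mathbf q}$ be the multiplication map, and for $n\ge1$ let $\partial^n:P^n\to P^{n-1}$ be the bimodule homomorphism which sends the generator $e_i\otimes_re_{i+n-2r}$ to $$e_i\otimes_r a_{i+n-2r-1}+(-1)^n\Big(\prod_{j=1}^{n-r}q_{i-r+j}\Big)e_i\otimes_{r-1}\bar a_{i+n-2r}+(-1)^n\Big[(-1)^r\Big(\prod_{j=1}^{r}q_{i-r+j}\Big)a_i\otimes_re_{i+n-2r}+(-1)^r\bar a_{i-1}\otimes_{r-1}e_{i+n-2r}\Big],$$ where the four terms lie in the summands of $P^{n-1}$ with indices $(i,r)$, $(i,r-1)$, $(i+1,r)$ and $(i-1,r-1)$ respectively. **Theorem.** Each $g^n_{r,i}$ is non-zero and satisfies $e_i\,g^n_{r,i}=g^n_{r,i}=g^n_{r,i}\,e_{i+n-2r}$.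 For $n\ge 1$ one also has $$g^n_{r,i}=(-1)^r\Big(\prod_{j=1}^{r}q_{i-r+j}\Big)a_i\,g^{n-1}_{r,i+1}+(-1)^r\,\bar a_{i-1}\,g^{n-1}_{r-1,i-1}$$ (so the coefficients in $\partial^n$ are those of the two recursions for $g^n_{r,i}$). Moreover, $(P^*,\partial^*)$ is a minimal projective bimodule resolution of $\Lambda_{\mathbf q}$. That is, every $P^n$ is a projective $\Lambda_{\mathbf q}$-bimodule (a projective module over the enveloping algebra of $\Lambda_{\mathbf q}$ over $K$), the sequence $$\cdots\to P^2\xrightarrow{\partial^2}P^1\xrightarrow{\partial^1}P^0\xrightarrow{\partial^0}\Lambda_{\mathbf q}\to0$$ is exact, and for every $n\ge0$ the kernel of $\partial^n$ is a superfluous submodule of $P^n$ (that is, $\ker\partial^n+L=P^n$ implies $L=P^n$), so that $P^n$ is a projective cover of $\operatorname{im}\partial^n$. -/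

import Mathlib

open scoped TensorProduct DirectSum
open MulOpposite

noncomputable section

/-- A path in a quiver together with its origin and its terminus. -/
abbrev APath (V : Type*) [Quiver V] := Σ (i : V) (j : V), Quiver.Path i j

/-- The path algebra `K Q` of a quiver with vertex set `V`: the vector space on all paths
(including the trivial ones), multiplied by concatenation, paths being written from left to
right. -/
def PathAlgebra (K : Type*) [Field K] (V : Type*) [Quiver V] := APath V →₀ K

namespace PathAlgebra

set_option linter.unusedSectionVars false

variable (K : Type*) [Field K] {V : Type*} [Quiver V]

instance : AddCommGroup (PathAlgebra K V) := inferInstanceAs (AddCommGroup (APath V →₀ K))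
instance : Module K (PathAlgebra K V) := inferInstanceAs (Module K (APath V →₀ K))

/-- The basis element given by a path. -/
def ofPath (p : APath V) : PathAlgebra K V := Finsupp.single p (1 : K)

/-- The trivial path at a vertex. -/
def triv (i : V) : PathAlgebra K V := ofPath K ⟨i, i, Quiver.Path.nil⟩

/-- The path of length one given by an arrow. -/
def ofArrow {i j : V} (f : i ⟶ j) : PathAlgebra K V := ofPath K ⟨i, j, f.toPath⟩

variable [DecidableEq V]

/-- The product of two paths: their concatenation if the first ends where the second one starts,
and zero otherwise. -/
def mulPath (p q : APath V) : PathAlgebra K V :=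
  if h : p.2.1 = q.1 then ofPath K ⟨p.1, q.2.1, p.2.2.comp (q.2.2.cast h.symm rfl)⟩ else 0

/-- The bilinear extension of `mulPath`. -/
def mulMap : PathAlgebra K V →ₗ[K] PathAlgebra K V →ₗ[K] PathAlgebra K V :=
  Finsupp.linearCombination K fun p : APath V =>
    (Finsupp.linearCombination K fun q : APath V => mulPath K p q :
      (APath V →₀ K) →ₗ[K] PathAlgebra K V)

instance : Mul (PathAlgebra K V) := ⟨fun x y => mulMap K x y⟩

theorem mul_def (x y : PathAlgebra K V) : x * y = mulMap K x y := rfl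

theorem ofPath_mul_ofPath (p q : APath V) : ofPath K p * ofPath K q = mulPath K p q := by
  rw [mul_def]
  unfold mulMap ofPath
  erw [Finsupp.linearCombination_single, one_smul, Finsupp.linearCombination_single, one_smul]

theorem ofPath_mul_ofPath_of_eq {i j k : V} (p : Quiver.Path i j) (q : Quiver.Path j k) :
    ofPath K (⟨i, j, p⟩ : APath V) * ofPath K ⟨j, k, q⟩ = ofPath K ⟨i, k, p.comp q⟩ := by
  rw [ofPath_mul_ofPath, mulPath, dif_pos rfl]
  rfl

theorem ofPath_mul_ofPath_of_ne {p q : APath V} (h : p.2.1 ≠ q.1) :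
    ofPath K p * ofPath K q = 0 := by
  rw [ofPath_mul_ofPath, mulPath, dif_neg h]

variable {K} in
theorem induction_on {motive : PathAlgebra K V → Prop} (x : PathAlgebra K V)
    (zero : motive 0) (add : ∀ x y, motive x → motive y → motive (x + y))
    (smul : ∀ (c : K) p, motive (c • ofPath K p)) : motive x := by
  refine Finsupp.induction_linear (motive := motive) x zero add fun p c => ?_
  have := smul c p
  rwa [show c • ofPath K p = Finsupp.single p c from by
    unfold ofPath; exact (Finsupp.smul_single c p 1).trans (by simp)] at this

theorem pa_smul_mul (c : K) (x y : PathAlgebra K V) : c • x * y = c • (x * y) := by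
  simp [mul_def]

theorem pa_mul_smul (c : K) (x y : PathAlgebra K V) : x * c • y = c • (x * y) := by
  simp [mul_def]

theorem pa_add_mul (x y z : PathAlgebra K V) : (x + y) * z = x * z + y * z := by
  simp [mul_def]

theorem pa_mul_add (x y z : PathAlgebra K V) : x * (y + z) = x * y + x * z := by
  simp [mul_def]

theorem pa_zero_mul (x : PathAlgebra K V) : 0 * x = 0 := by simp [mul_def]

theorem pa_mul_zero (x : PathAlgebra K V) : x * 0 = 0 := by simp [mul_def]

theorem ofPath_assoc (p q r : APath V) :
    ofPath K p * ofPath K q * ofPath K r = ofPath K p * (ofPath K q * ofPath K r) := by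
  obtain ⟨i, j, p⟩ := p
  obtain ⟨j', k, q⟩ := q
  obtain ⟨k', l, r⟩ := r
  by_cases h : j = j'
  · subst h
    by_cases h' : k = k'
    · subst h'
      simp only [ofPath_mul_ofPath_of_eq, Quiver.Path.comp_assoc]
    · rw [ofPath_mul_ofPath_of_eq, ofPath_mul_ofPath_of_ne K (by exact h'),
        ofPath_mul_ofPath_of_ne K (by exact h'), pa_mul_zero]
  · rw [ofPath_mul_ofPath_of_ne K (by exact h), pa_zero_mul]
    by_cases h' : k = k'
    · subst h'
      rw [ofPath_mul_ofPath_of_eq, ofPath_mul_ofPath_of_ne K (by exact h)]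
    · rw [ofPath_mul_ofPath_of_ne K (p := ⟨j', k, q⟩) (by exact h'), pa_mul_zero]

theorem pa_mul_assoc (x y z : PathAlgebra K V) : x * y * z = x * (y * z) := by
  induction x using induction_on with
  | zero => simp only [pa_zero_mul]
  | add x x' hx hx' => simp only [pa_add_mul, hx, hx']
  | smul c p =>
    induction y using induction_on with
    | zero => simp only [pa_zero_mul, pa_mul_zero]
    | add y y' hy hy' => simp only [pa_add_mul, pa_mul_add, hy, hy']
    | smul d p' =>
      induction z using induction_on with
      | zero => simp only [pa_mul_zero]
      | add z z' hz hz' => simp only [pa_mul_add, hz, hz']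
      | smul b p'' => simp only [pa_smul_mul, pa_mul_smul, ofPath_assoc]

theorem triv_mul_ofPath (v : V) (p : APath V) :
    triv K v * ofPath K p = if v = p.1 then ofPath K p else 0 := by
  obtain ⟨i, j, p⟩ := p
  by_cases h : v = i
  · subst h
    rw [triv, ofPath_mul_ofPath_of_eq, if_pos rfl, Quiver.Path.nil_comp]
  · rw [triv, ofPath_mul_ofPath_of_ne K (by exact h), if_neg h]

theorem ofPath_mul_triv (v : V) (p : APath V) :
    ofPath K p * triv K v = if v = p.2.1 then ofPath K p else 0 := by
  obtain ⟨i, j, p⟩ := p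
  by_cases h : v = j
  · subst h
    rw [triv, ofPath_mul_ofPath_of_eq, if_pos rfl, Quiver.Path.comp_nil]
  · rw [triv, ofPath_mul_ofPath_of_ne K (Ne.symm h), if_neg h]

variable [Fintype V]

instance : One (PathAlgebra K V) := ⟨∑ i : V, triv K i⟩

theorem one_def : (1 : PathAlgebra K V) = ∑ i : V, triv K i := rfl

theorem pa_one_mul (x : PathAlgebra K V) : 1 * x = x := by
  induction x using induction_on with
  | zero => exact pa_mul_zero K 1
  | add x y hx hy => rw [pa_mul_add, hx, hy]
  | smul c p =>
    rw [pa_mul_smul, one_def, mul_def, map_sum, LinearMap.sum_apply]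
    simp only [← mul_def, triv_mul_ofPath]
    simp

theorem pa_mul_one (x : PathAlgebra K V) : x * 1 = x := by
  induction x using induction_on with
  | zero => exact pa_zero_mul K 1
  | add x y hx hy => rw [pa_add_mul, hx, hy]
  | smul c p =>
    rw [pa_smul_mul, one_def, mul_def, map_sum]
    simp only [← mul_def, ofPath_mul_triv]
    simp

instance : Ring (PathAlgebra K V) :=
  { (inferInstance : AddCommGroup (PathAlgebra K V)),
    (inferInstance : Mul (PathAlgebra K V)),
    (inferInstance : One (PathAlgebra K V)) with
    left_distrib := pa_mul_add K
    right_distrib := pa_add_mul K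
    zero_mul := pa_zero_mul K
    mul_zero := pa_mul_zero K
    mul_assoc := pa_mul_assoc K
    one_mul := pa_one_mul K
    mul_one := pa_mul_one K }

instance : Algebra K (PathAlgebra K V) := Algebra.ofModule (pa_smul_mul K) (pa_mul_smul K)

/-- A non-zero element `x` with `x = e_v x = x e_w`, that is, a uniform element with origin `v`
and terminus `w`. -/
def IsUniform {K : Type*} [Field K] (x : PathAlgebra K V) (v w : V) : Prop :=
  x ≠ 0 ∧ triv K v * x = x ∧ x * triv K w = x

end PathAlgebra

/-- A submodule `N` of `M` is superfluous (small) if `N + L = M` forces `L = M`. -/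
def IsSuperfluous {R M : Type*} [Ring R] [AddCommGroup M] [Module R M]
    (N : Submodule R M) : Prop :=
  ∀ L : Submodule R M, N ⊔ L = ⊤ → L = ⊤

/-- The complex `⋯ → P 2 → P 1 → P 0` with augmentation `ε : P 0 → M` is a minimal projective
resolution of `M`: it is an exact complex of projective modules ending in `P 0 → M → 0`, and each
`P n` is a projective cover of its image, that is, the kernel of each map is superfluous. -/
structure IsMinimalProjectiveResolution {R M : Type*} [Ring R] [AddCommGroup M] [Module R M]
    {P : ℕ → Type*} [∀ n, AddCommGroup (P n)] [∀ n, Module R (P n)]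
    (d : ∀ n, P (n + 1) →ₗ[R] P n) (ε : P 0 →ₗ[R] M) : Prop where
  projective : ∀ n, Module.Projective R (P n)
  surjective : Function.Surjective ε
  exact_zero : Function.Exact (d 0) ε
  exact_succ : ∀ n, Function.Exact (d (n + 1)) (d n)
  minimal_zero : IsSuperfluous (LinearMap.ker ε)
  minimal_succ : ∀ n, IsSuperfluous (LinearMap.ker (d n))

namespace DeformedCycle

/-- The arrows of the cyclic quiver with vertices `ℤ/m`: for each `i` an arrow `a_i : i → i + 1`
and an arrow `ā_i : i + 1 → i`. -/
inductive Arrow (m : ℕ) : ZMod m → ZMod m → Type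
  | a (i : ZMod m) : Arrow m i (i + 1)
  | abar (i : ZMod m) : Arrow m (i + 1) i

instance cyclicQuiver (m : ℕ) : Quiver (ZMod m) := ⟨Arrow m⟩

section

variable (K : Type*) [Field K] {m : ℕ}

/-- The arrow `a_i : i → i + 1` as an element of the path algebra. -/
def pathA (i : ZMod m) : PathAlgebra K (ZMod m) := PathAlgebra.ofArrow K (Arrow.a i)

/-- The arrow `ā_i : i + 1 → i` as an element of the path algebra. -/
def pathAbar (i : ZMod m) : PathAlgebra K (ZMod m) := PathAlgebra.ofArrow K (Arrow.abar i)

end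

variable {K : Type*} [Field K] {m : ℕ} [NeZero m] (q : ZMod m → Kˣ)

/-- The generators `a_i a_{i+1}`, `ā_{i-1} ā_{i-2}` and `q_i a_i ā_i - ā_{i-1} a_{i-1}` of
the ideal of relations. -/
def relations : Set (PathAlgebra K (ZMod m)) :=
  {x | ∃ i : ZMod m, x = pathA K i * pathA K (i + 1) ∨
    x = pathAbar K (i - 1) * pathAbar K (i - 2) ∨
    x = (q i : K) • (pathA K i * pathAbar K i) - pathAbar K (i - 1) * pathA K (i - 1)}

/-- The algebra `Λ_q = K Q / I_q`, the quotient of the path algebra by the two-sided ideal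
generated by the relations. -/
def Lam := (TwoSidedIdeal.span (relations q)).ringCon.Quotient

instance : Ring (Lam q) :=
  inferInstanceAs (Ring (TwoSidedIdeal.span (relations q)).ringCon.Quotient)
instance : Algebra K (Lam q) :=
  inferInstanceAs (Algebra K (TwoSidedIdeal.span (relations q)).ringCon.Quotient)

/-- The quotient map `K Q → Λ_q`. -/
def proj : PathAlgebra K (ZMod m) →+* Lam q := (TwoSidedIdeal.span (relations q)).ringCon.mk'

/-- The image of the trivial path `e_i` in `Λ_q`. -/
def e (i : ZMod m) : Lam q := proj q (PathAlgebra.triv K i)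

/-- The image of the arrow `a_i` in `Λ_q`. -/
def a (i : ZMod m) : Lam q := proj q (pathA K i)

/-- The image of the arrow `ā_i` in `Λ_q`. -/
def abar (i : ZMod m) : Lam q := proj q (pathAbar K i)

/-- The product `q_s q_{s+1} ⋯ q_{s+k-1}` of `k` terms, which is `1` if `k ≤ 0`. -/
def qprod (s : ZMod m) (k : ℤ) : K := ∏ j ∈ Finset.range k.toNat, (q (s + j) : K)

/-- The elements `g^n_{r,i}` of the path algebra, for all integers `r`; they vanish unless
`0 ≤ r ≤ n`. -/
def g : ℕ → ℤ → ZMod m → PathAlgebra K (ZMod m)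
  | 0, r, i => if r = 0 then PathAlgebra.triv K i else 0
  | n + 1, r, i =>
      g n r i * pathA K (i + ((n + 1 : ℕ) : ZMod m) - 2 * (r : ZMod m) - 1) +
        ((-1) ^ (n + 1) * qprod q (i - r + 1) ((n + 1 : ℕ) - r)) •
          (g n (r - 1) i * pathAbar K (i + ((n + 1 : ℕ) : ZMod m) - 2 * (r : ZMod m)))

/-- The enveloping algebra of `Λ_q`, whose left modules are the `Λ_q`-bimodules on which `K` acts
centrally. -/
def Env := Lam q ⊗[K] (Lam q)ᵐᵒᵖ

instance : Ring (Env q) := inferInstanceAs (Ring (Lam q ⊗[K] (Lam q)ᵐᵒᵖ))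
instance : Algebra K (Env q) := inferInstanceAs (Algebra K (Lam q ⊗[K] (Lam q)ᵐᵒᵖ))

/-- The element `x ⊗ y` of the enveloping algebra, which acts on bimodules by `v ↦ x v y`. -/
def tens (x y : Lam q) : Env q := (x ⊗ₜ[K] op y : Lam q ⊗[K] (Lam q)ᵐᵒᵖ)

theorem tens_mul_tens (x y x' y' : Lam q) :
    tens q x y * tens q x' y' = tens q (x * x') (y' * y) :=
  Algebra.TensorProduct.tmul_mul_tmul x x' (op y) (op y')

/-- `Λ_q` as a bimodule over itself. -/
instance : Module (Env q) (Lam q) := instModuleTensorProductMop K (Lam q)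

theorem tens_smul (x y v : Lam q) : tens q x y • v = x * v * y := by
  change TensorProduct.Algebra.moduleAux (R := K) (x ⊗ₜ[K] op y) v = _
  simp [TensorProduct.Algebra.moduleAux, ← mul_assoc]

/-- The element `e_i ⊗ e_j` of the enveloping algebra. -/
def idem (i j : ZMod m) : Env q := tens q (e q i) (e q j)

/-- The bimodule `Λ_q e_i ⊗ e_j Λ_q`, as the left ideal of the enveloping algebra generated by
`e_i ⊗ e_j`; see `summand_eq` for the comparison. -/
def summand (i j : ZMod m) : Submodule (Env q) (Env q) := Submodule.span (Env q) {idem q i j}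

/-- As a vector space, `summand q i j` is the image in `Λ_q ⊗ Λ_q` of the tensor product of the
subspaces `Λ_q e_i` and `e_j Λ_q`. -/
theorem summand_eq (i j : ZMod m) :
    (summand q i j : Set (Env q)) =
      _root_.Set.range (TensorProduct.map (LinearMap.mulRight K (e q i))
        ((opLinearEquiv K).toLinearMap ∘ₗ LinearMap.mulLeft K (e q j))) := by
  ext z
  simp only [SetLike.mem_coe, summand, Submodule.mem_span_singleton]
  constructor
  · rintro ⟨w, rfl⟩
    rw [smul_eq_mul]
    induction w using TensorProduct.induction_on with
    | zero => exact ⟨0, (map_zero _).trans (zero_mul (idem q i j)).symm⟩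
    | tmul x y => exact ⟨x ⊗ₜ y.unop, (tens_mul_tens q x y.unop _ _).symm⟩
    | add x y hx hy =>
      obtain ⟨x', hx⟩ := hx
      obtain ⟨y', hy⟩ := hy
      refine ⟨x' + y', ?_⟩
      rw [map_add, hx, hy]
      exact (add_mul (x : Env q) y (idem q i j)).symm
  · rintro ⟨w, rfl⟩
    induction w using TensorProduct.induction_on with
    | zero => exact ⟨0, (zero_mul (idem q i j)).trans (map_zero _).symm⟩
    | tmul x y => exact ⟨tens q x y, tens_mul_tens q x y _ _⟩
    | add x y hx hy =>
      obtain ⟨x', hx⟩ := hx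
      obtain ⟨y', hy⟩ := hy
      refine ⟨x' + y', ?_⟩
      rw [map_add, ← hx, ← hy]
      exact add_mul (x' : Env q) y' (idem q i j)

/-- The bimodule `P^n`, the direct sum of the `Λ_q e_i ⊗ e_{i+n-2r} Λ_q` over all vertices `i` and
all `0 ≤ r ≤ n`. -/
def P (n : ℕ) := ⨁ s : ZMod m × Fin (n + 1), summand q s.1 (s.1 + n - 2 * (s.2 : ℕ))

instance (n : ℕ) : AddCommGroup (P q n) :=
  inferInstanceAs
    (AddCommGroup (⨁ s : ZMod m × Fin (n + 1), summand q s.1 (s.1 + n - 2 * (s.2 : ℕ))))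
instance (n : ℕ) : Module (Env q) (P q n) :=
  inferInstanceAs
    (Module (Env q) (⨁ s : ZMod m × Fin (n + 1), summand q s.1 (s.1 + n - 2 * (s.2 : ℕ))))

/-- The inclusion into `P^n` of the summand belonging to `g^n_{r,i}`, where `s = (i, r)`. -/
def incl (n : ℕ) (s : ZMod m × Fin (n + 1)) :
    summand q s.1 (s.1 + n - 2 * (s.2 : ℕ)) →ₗ[Env q] P q n :=
  DirectSum.lof (Env q) (ZMod m × Fin (n + 1))
    (fun s => summand q s.1 (s.1 + n - 2 * (s.2 : ℕ))) s

/-- The homomorphism on `P^n` given by homomorphisms on all summands. -/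
def lift (n : ℕ) {M : Type*} [AddCommGroup M] [Module (Env q) M]
    (f : ∀ s : ZMod m × Fin (n + 1), summand q s.1 (s.1 + n - 2 * (s.2 : ℕ)) →ₗ[Env q] M) :
    P q n →ₗ[Env q] M :=
  DirectSum.toModule (Env q) (ZMod m × Fin (n + 1)) M f

theorem lift_incl (n : ℕ) {M : Type*} [AddCommGroup M] [Module (Env q) M]
    (f : ∀ s : ZMod m × Fin (n + 1), summand q s.1 (s.1 + n - 2 * (s.2 : ℕ)) →ₗ[Env q] M)
    (s : ZMod m × Fin (n + 1)) (x : summand q s.1 (s.1 + n - 2 * (s.2 : ℕ))) :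
    lift q n f (incl q n s x) = f s x := by
  have := DirectSum.toModule_lof (Env q) (φ := f) s x
  exact this

/-- The generator `e_i ⊗_r e_{i+n-2r}` of the summand of `P^n` belonging to `g^n_{r,i}`; it is
zero unless `0 ≤ r ≤ n`. -/
def gen (n : ℕ) (r : ℤ) (i : ZMod m) : P q n :=
  if h : 0 ≤ r ∧ r ≤ n then
    incl q n (i, ⟨r.toNat, by omega⟩)
      ⟨idem q i (i + n - 2 * (r.toNat : ℕ)), Submodule.mem_span_singleton_self _⟩
  else 0

/-- Left multiplication by `x` on bimodules. -/
def lmul (x : Lam q) : Env q := tens q x 1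

/-- Right multiplication by `y` on bimodules. -/
def rmul (y : Lam q) : Env q := tens q 1 y

/-- The image of the generator `e_i ⊗_r e_{i+n-2r}` of `P^n` under the differential
`∂^n : P^n → P^{n-1}`, where `n = k + 1`. -/
def diffGen (k : ℕ) (r : ℤ) (i : ZMod m) : P q k :=
  let n : ℕ := k + 1
  rmul q (a q (i + n - 2 * r - 1)) • gen q k r i +
    (((-1) ^ n * qprod q (i - r + 1) (n - r)) • rmul q (abar q (i + n - 2 * r))) •
      gen q k (r - 1) i +
    (((-1) ^ n * ((-1) ^ r.toNat * qprod q (i - r + 1) r)) • lmul q (a q i)) •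
      gen q k r (i + 1) +
    (((-1 : K) ^ n * (-1) ^ r.toNat) • lmul q (abar q (i - 1))) • gen q k (r - 1) (i - 1)

/-- The differential `∂^{k+1} : P^{k+1} → P^k`: the bimodule homomorphism with
`e_i ⊗_r e_{i+k+1-2r} ↦ diffGen q k r i`; see `diff_gen`. -/
def diff (k : ℕ) : P q (k + 1) →ₗ[Env q] P q k :=
  lift q _ fun s =>
    (LinearMap.toSpanSingleton (Env q) (P q k) (diffGen q k (s.2 : ℕ) s.1)).domRestrict
      (summand q s.1 (s.1 + (k + 1 : ℕ) - 2 * (s.2 : ℕ)))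

/-- The multiplication map `∂^0 : P^0 → Λ_q`, `x ⊗ y ↦ x y`. -/
def aug : P q 0 →ₗ[Env q] Lam q :=
  lift q _ fun s =>
    (LinearMap.toSpanSingleton (Env q) (Lam q) 1).domRestrict
      (summand q s.1 (s.1 + (0 : ℕ) - 2 * (s.2 : ℕ)))

theorem e_mul_e (i : ZMod m) : e q i * e q i = e q i := by
  rw [e, ← map_mul]
  congr 1
  exact (PathAlgebra.triv_mul_ofPath K i _).trans (if_pos rfl)

theorem e_mul_a (i : ZMod m) : e q i * a q i = a q i := by
  rw [e, a, ← map_mul]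
  congr 1
  exact (PathAlgebra.triv_mul_ofPath K i _).trans (if_pos rfl)

theorem a_mul_e (i j : ZMod m) (h : j = i + 1) : a q i * e q j = a q i := by
  rw [e, a, ← map_mul]
  congr 1
  exact (PathAlgebra.ofPath_mul_triv K j _).trans (if_pos h)

theorem e_mul_abar (i j : ZMod m) (h : j = i + 1) : e q j * abar q i = abar q i := by
  rw [e, abar, ← map_mul]
  congr 1
  exact (PathAlgebra.triv_mul_ofPath K j _).trans (if_pos h)

theorem abar_mul_e (i : ZMod m) : abar q i * e q i = abar q i := by
  rw [e, abar, ← map_mul]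
  congr 1
  exact (PathAlgebra.ofPath_mul_triv K i _).trans (if_pos rfl)

theorem smul_gen {n : ℕ} {r : ℤ} {i j : ZMod m} {z w : Env q} (hj : j = i + n - 2 * r)
    (h : z * idem q i j = w * idem q i j) : z • gen q n r i = w • gen q n r i := by
  unfold gen
  split_ifs with hr
  · rw [← map_smul, ← map_smul]
    congr 1
    apply Subtype.ext
    have : i + n - 2 * (r.toNat : ℕ) = j := by
      obtain ⟨r, rfl⟩ := Int.eq_ofNat_of_zero_le hr.1
      rw [hj]
      simp
    simpa [this] using h
  · simp

theorem idem_smul_smul_gen {n : ℕ} {r : ℤ} {i i' j j' : ZMod m} {x y : Lam q} (c : K)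
    (hj : j' = i' + n - 2 * r) (hx : e q i * (x * e q i') = x * e q i')
    (hy : e q j' * y * e q j = e q j' * y) :
    idem q i j • (c • tens q x y) • gen q n r i' = (c • tens q x y) • gen q n r i' := by
  rw [← mul_smul]
  refine smul_gen q hj ?_
  simp only [idem, mul_smul_comm, smul_mul_assoc, tens_mul_tens, mul_assoc] at hx hy ⊢
  rw [hx, hy]

theorem idem_smul_diffGen (k : ℕ) (r : ℤ) (i : ZMod m) :
    idem q i (i + (k + 1 : ℕ) - 2 * r) • diffGen q k r i = diffGen q k r i := by
  unfold diffGen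
  simp only [smul_add, lmul, rmul]
  refine congrArg₂ _ (congrArg₂ _ (congrArg₂ _ ?_ ?_) ?_) ?_
  · rw [← one_smul K (tens q 1 _)]
    refine idem_smul_smul_gen q _ rfl ?_ ?_
    · simp only [one_mul, e_mul_e]
    · rw [mul_assoc, a_mul_e _ _ _ (by push_cast; ring)]
  · refine idem_smul_smul_gen q _ rfl ?_ ?_
    · simp only [one_mul, e_mul_e]
    · rw [mul_assoc, abar_mul_e]
  · refine idem_smul_smul_gen q _ rfl ?_ ?_
    · rw [a_mul_e _ _ _ rfl, e_mul_a]
    · rw [mul_one, show i + 1 + (k : ZMod m) - 2 * (r : ZMod m) = i + (k + 1 : ℕ) - 2 * r by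
        push_cast; ring, e_mul_e]
  · refine idem_smul_smul_gen q _ rfl ?_ ?_
    · rw [abar_mul_e, e_mul_abar _ _ _ (by ring)]
    · rw [mul_one, show i - 1 + (k : ZMod m) - 2 * ((r - 1 : ℤ) : ZMod m) =
        i + (k + 1 : ℕ) - 2 * r by push_cast; ring, e_mul_e]

/-- The differential sends the generators to the prescribed elements. -/
theorem diff_gen (k : ℕ) (r : ℤ) (i : ZMod m) (h0 : 0 ≤ r) (h1 : r ≤ (k + 1 : ℕ)) :
    diff q k (gen q (k + 1) r i) = diffGen q k r i := by
  obtain ⟨r, rfl⟩ := Int.eq_ofNat_of_zero_le h0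
  rw [gen, dif_pos ⟨h0, h1⟩, diff, lift_incl]
  simpa using idem_smul_diffGen q k r i

/-- The map `∂^0` is multiplication. -/
theorem aug_incl (s : ZMod m × Fin 1) (z : summand q s.1 (s.1 + (0 : ℕ) - 2 * (s.2 : ℕ)))
    (x y : Lam q) (hz : (z : Env q) = tens q x y) : aug q (incl q 0 s z) = x * y := by
  rw [aug, lift_incl]
  change (z : Env q) • (1 : Lam q) = _
  rw [hz, tens_smul, mul_one]

end DeformedCycle

end

/-! The elements `e`, `a`, `abar`, `soc`, one of each kind per vertex, form a basis of Λ_q. They are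
independent because an explicit left regular representation separates them; they span because
`ofCoords` intertwines that representation with left multiplication (`ofCoords_rep`,
`ofCoords_coords`). Any product of three arrows is zero.

The left recursion for g and the identity ∂² = 0 rest on the same coefficient identity,
`qprod_mul_qprod`, which makes the mixed terms (one arrow on each side) agree up to sign. In ∂² the
one-sided terms vanish because aa = 0 and āā = 0, or cancel because ā_{i-1} a_{i-1} = q_i a_i ā_i.

Exactness is tested modulo the right radical. In P^n / P^n·rad the terms of ∂ with an arrow on the
right disappear, and what remains is the candidate minimal resolution of Λ_q / rad by left modules.
There basis elements pair off across neighbouring degrees: ā_i ⊗_r with e_{i+1} ⊗_{r+1}, a_i ā_i ⊗_r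
with a_i ⊗_{r+1}, and a_{i-1} ⊗_0 with e_{i-1} ⊗_0, the second member being one degree higher. Only
the e_i ⊗_0 of degree 0 stay unpaired, and they account for Λ_q / rad. The pairing gives a homotopy
h, extended to P by right linearity. Then N = ∂h + h∂ - 1 is right linear with image in P·rad
(`homotopy_succ`, `homotopy_zero`), so N³ = 0 (`cube_eq_zero`). An identity map homotopic to a
nilpotent map forces exactness (`exact_of_cube_eq_zero`).

Minimality follows: by exactness each kernel is an image, every term of ∂ carries an arrow on one
side, and the Nakayama lemma applies to each side in turn. -/

noncomputable section

set_option linter.unusedSectionVars false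

/-! ### Linear extension and products in the path algebra -/

namespace PathAlgebra

variable {K : Type*} [Field K] {V : Type*} [Quiver V]

/-- The linear extension to the path algebra of a function on paths. -/
def extend {M : Type*} [AddCommGroup M] [Module K M] (f : APath V → M) :
    PathAlgebra K V →ₗ[K] M :=
  (Finsupp.linearCombination K f : (APath V →₀ K) →ₗ[K] M)

theorem extend_ofPath {M : Type*} [AddCommGroup M] [Module K M] (f : APath V → M) (p : APath V) :
    extend f (ofPath K p) = f p := by
  change Finsupp.linearCombination K f (Finsupp.single p 1) = f p
  simp

theorem ofPath_mul_ofArrow [DecidableEq V] {i j k : V} (p : Quiver.Path i j) (f : j ⟶ k) :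
    ofPath K (⟨i, j, p⟩ : APath V) * ofArrow K f = ofPath K ⟨i, k, p.cons f⟩ := by
  rw [ofArrow, ofPath_mul_ofPath_of_eq]
  rfl

theorem triv_mul_triv [DecidableEq V] (v w : V) :
    triv K v * triv K w = if v = w then triv K v else 0 := by
  rw [triv, triv, ← triv, triv_mul_ofPath]
  split_ifs with h
  · subst h; rfl
  · rfl

theorem triv_mul_ofArrow [DecidableEq V] {i j : V} (f : i ⟶ j) (v : V) :
    triv K v * ofArrow K f = if v = i then ofArrow K f else 0 :=
  triv_mul_ofPath K v _

theorem ofArrow_mul_triv [DecidableEq V] {i j : V} (f : i ⟶ j) (v : V) :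
    ofArrow K f * triv K v = if v = j then ofArrow K f else 0 :=
  ofPath_mul_triv K v _

end PathAlgebra

namespace DeformedCycle

open PathAlgebra

/-! ### Deletion of the last arrow of a path -/

section

variable (K : Type*) [Field K] {m : ℕ}

/-- Removal of the last arrow `a_k` from a path; zero on the paths which do not end in such an
arrow. -/
def dropAPath : APath (ZMod m) → PathAlgebra K (ZMod m)
  | ⟨_, _, .nil⟩ => 0
  | ⟨i, _, .cons p f⟩ =>
    match f with
    | Arrow.a k => ofPath K ⟨i, k, p⟩
    | Arrow.abar _ => 0

/-- Removal of the last arrow `ā_k` from a path; zero on the paths which do not end in such an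
arrow. -/
def dropAbarPath : APath (ZMod m) → PathAlgebra K (ZMod m)
  | ⟨_, _, .nil⟩ => 0
  | ⟨i, _, .cons p f⟩ =>
    match f with
    | Arrow.a _ => 0
    | Arrow.abar k => ofPath K ⟨i, k + 1, p⟩

variable {K}

/-- The factor `triv K k` records that paths not ending at the origin of a_k are killed by the
product. -/
theorem extend_dropAPath_mul_pathA (x : PathAlgebra K (ZMod m)) (k : ZMod m) :
    extend (dropAPath K) (x * pathA K k) = x * triv K k := by
  induction x using PathAlgebra.induction_on with
  | zero => simp only [pa_zero_mul, map_zero]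
  | add x y hx hy => simp only [pa_add_mul, map_add, hx, hy]
  | smul c p =>
    obtain ⟨i, j, p⟩ := p
    rw [pa_smul_mul, pa_smul_mul, map_smul, pathA]
    by_cases h : k = j
    · subst h
      rw [ofPath_mul_ofArrow, extend_ofPath, ofPath_mul_triv, if_pos rfl]
      rfl
    · rw [ofArrow, ofPath_mul_ofPath_of_ne K (Ne.symm h), ofPath_mul_triv, if_neg h, map_zero]

theorem extend_dropAPath_mul_pathAbar (x : PathAlgebra K (ZMod m)) (k : ZMod m) :
    extend (dropAPath K) (x * pathAbar K k) = 0 := by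
  induction x using PathAlgebra.induction_on with
  | zero => simp only [pa_zero_mul, map_zero]
  | add x y hx hy => simp only [pa_add_mul, map_add, hx, hy, add_zero]
  | smul c p =>
    obtain ⟨i, j, p⟩ := p
    rw [pa_smul_mul, map_smul, pathAbar]
    by_cases h : k + 1 = j
    · subst h
      rw [ofPath_mul_ofArrow, extend_ofPath]
      exact smul_zero c
    · rw [ofArrow, ofPath_mul_ofPath_of_ne K (Ne.symm h), map_zero, smul_zero]

theorem extend_dropAbarPath_mul_pathA (x : PathAlgebra K (ZMod m)) (k : ZMod m) :
    extend (dropAbarPath K) (x * pathA K k) = 0 := by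
  induction x using PathAlgebra.induction_on with
  | zero => simp only [pa_zero_mul, map_zero]
  | add x y hx hy => simp only [pa_add_mul, map_add, hx, hy, add_zero]
  | smul c p =>
    obtain ⟨i, j, p⟩ := p
    rw [pa_smul_mul, map_smul, pathA]
    by_cases h : k = j
    · subst h
      rw [ofPath_mul_ofArrow, extend_ofPath]
      exact smul_zero c
    · rw [ofArrow, ofPath_mul_ofPath_of_ne K (Ne.symm h), map_zero, smul_zero]

theorem extend_dropAbarPath_mul_pathAbar (x : PathAlgebra K (ZMod m)) (k : ZMod m) :
    extend (dropAbarPath K) (x * pathAbar K k) = x * triv K (k + 1) := by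
  induction x using PathAlgebra.induction_on with
  | zero => simp only [pa_zero_mul, map_zero]
  | add x y hx hy => simp only [pa_add_mul, map_add, hx, hy]
  | smul c p =>
    obtain ⟨i, j, p⟩ := p
    rw [pa_smul_mul, pa_smul_mul, map_smul, pathAbar]
    by_cases h : k + 1 = j
    · subst h
      rw [ofPath_mul_ofArrow, extend_ofPath, ofPath_mul_triv, if_pos rfl]
      rfl
    · rw [ofArrow, ofPath_mul_ofPath_of_ne K (Ne.symm h), ofPath_mul_triv, if_neg h, map_zero]

end

variable {K : Type*} [Field K] {m : ℕ} [NeZero m] (q : ZMod m → Kˣ)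

/-! ### The coefficients and the two recursions for g -/

theorem qprod_of_nonpos (s : ZMod m) {k : ℤ} (hk : k ≤ 0) : qprod q s k = 1 := by
  rw [qprod, Int.toNat_of_nonpos hk, Finset.prod_range_zero]

theorem qprod_ne_zero (s : ZMod m) (k : ℤ) : qprod q s k ≠ 0 :=
  Finset.prod_ne_zero_iff.mpr fun _ _ => Units.ne_zero _

theorem qprod_add_one (s : ZMod m) {k : ℤ} (hk : 0 ≤ k) :
    qprod q s (k + 1) = qprod q s k * q (s + k) := by
  obtain ⟨k, rfl⟩ := Int.eq_ofNat_of_zero_le hk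
  simp [qprod, show ((k : ℤ) + 1).toNat = k + 1 from rfl, Finset.prod_range_succ]

theorem qprod_add_one' (s : ZMod m) {k : ℤ} (hk : 0 ≤ k) :
    qprod q s (k + 1) = q s * qprod q (s + 1) k := by
  obtain ⟨k, rfl⟩ := Int.eq_ofNat_of_zero_le hk
  simp [qprod, show ((k : ℤ) + 1).toNat = k + 1 from rfl, Finset.prod_range_succ', mul_comm,
    add_comm, add_left_comm]

/-- The compatibility of the coefficients in the left and in the right recursion. -/
theorem qprod_mul_qprod (i : ZMod m) {n r : ℤ} (h1 : 1 ≤ r) (h2 : r ≤ n) :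
    qprod q (i - r + 1) (n + 1 - r) * qprod q (i - (r - 1 : ℤ) + 1) (r - 1) =
      qprod q (i - r + 1) r * qprod q (i + 1 - r + 1) (n - r) := by
  -- With r = s + 1, splitting the first factor off the longer product on each side leaves q_{i-s}
  -- times the products of lengths n - r and r - 1 starting at i - s + 1.
  obtain ⟨s, rfl⟩ : ∃ s, r = s + 1 := ⟨r - 1, by ring⟩
  obtain ⟨t, rfl⟩ : ∃ t, n = t + (s + 1) := ⟨n - (s + 1), by ring⟩
  rw [show t + (s + 1) + 1 - (s + 1) = t + 1 by ring, qprod_add_one' q _ (by omega),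
    qprod_add_one' q _ (by omega : 0 ≤ s)]
  simp only [add_sub_cancel_right]
  rw [show i - ((s + 1 : ℤ) : ZMod m) + 1 + 1 = i - s + 1 by push_cast; ring,
    show i + 1 - ((s + 1 : ℤ) : ZMod m) + 1 = i - s + 1 by push_cast; ring]
  ring

theorem neg_one_pow_toNat {r : ℤ} (h : 1 ≤ r) :
    ((-1 : K)) ^ r.toNat = -(-1) ^ (r - 1).toNat := by
  rw [show r.toNat = (r - 1).toNat + 1 by omega, pow_succ]
  ring

theorem g_succ (n : ℕ) (r : ℤ) (i : ZMod m) :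
    g q (n + 1) r i =
      g q n r i * pathA K (i + ((n + 1 : ℕ) : ZMod m) - 2 * (r : ZMod m) - 1) +
        ((-1) ^ (n + 1) * qprod q (i - r + 1) ((n + 1 : ℕ) - r)) •
          (g q n (r - 1) i * pathAbar K (i + ((n + 1 : ℕ) : ZMod m) - 2 * (r : ZMod m))) := rfl

theorem g_eq_zero (n : ℕ) (r : ℤ) (i : ZMod m) (h : r < 0 ∨ n < r) : g q n r i = 0 := by
  induction n generalizing r with
  | zero => exact if_neg (by omega)
  | succ n ih =>
    rw [g_succ, ih r (by push_cast at h; omega), ih (r - 1) (by push_cast at h; omega),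
      zero_mul, zero_mul, smul_zero, add_zero]

theorem triv_mul_g (n : ℕ) (r : ℤ) (i : ZMod m) : triv K i * g q n r i = g q n r i := by
  induction n generalizing r with
  | zero =>
    rw [g]
    split_ifs
    · rw [triv_mul_triv, if_pos rfl]
    · rw [mul_zero]
  | succ n ih => rw [g_succ, mul_add, mul_smul_comm, ← mul_assoc, ← mul_assoc, ih, ih]

theorem g_mul_triv (n : ℕ) (r : ℤ) (i : ZMod m) :
    g q n r i * triv K (i + n - 2 * r) = g q n r i := by
  cases n with
  | zero =>
    rw [g]
    split_ifs with h
    · subst h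
      rw [triv_mul_triv, if_pos (by simp)]
    · rw [zero_mul]
  | succ n =>
    rw [g_succ, add_mul, smul_mul_assoc, mul_assoc, mul_assoc, pathA, pathAbar, ofArrow_mul_triv,
      ofArrow_mul_triv, if_pos (by ring), if_pos rfl]

/-- The two summands of the recursion end in different kinds of arrows, so deleting a last arrow
isolates one of them and returns, up to a unit, a g of smaller degree. -/
theorem g_ne_zero (n : ℕ) (r : ℤ) (i : ZMod m) (h0 : 0 ≤ r) (h1 : r ≤ n) : g q n r i ≠ 0 := by
  induction n generalizing r with
  | zero =>
    rw [g, if_pos (by push_cast at h1; omega)]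
    exact Finsupp.single_ne_zero.mpr one_ne_zero
  | succ n ih =>
    intro hg
    rw [g_succ] at hg
    -- For r = n + 1 the summand ending in an arrow a is zero, so the one ending in ā is used.
    by_cases h : r ≤ n
    · refine ih r h0 h ?_
      have := congrArg (extend (dropAPath K)) hg
      rw [map_add, map_smul, extend_dropAPath_mul_pathA, extend_dropAPath_mul_pathAbar, smul_zero,
        add_zero, map_zero] at this
      rw [← g_mul_triv, ← this]
      congr 2
      push_cast
      ring
    · refine ih (r - 1) (by omega) (by push_cast at h1; omega) ?_
      have := congrArg (extend (dropAbarPath K)) hg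
      rw [map_add, map_smul, extend_dropAbarPath_mul_pathA, extend_dropAbarPath_mul_pathAbar,
        zero_add, map_zero, smul_eq_zero_iff_right (mul_ne_zero (by simp)
          (qprod_ne_zero q _ _))] at this
      rw [← g_mul_triv, ← this]
      congr 2
      push_cast
      ring

/-- The left recursion for the elements `g^n_{r,i}`. -/
theorem g_succ_left (n : ℕ) (r : ℤ) (i : ZMod m) :
    g q (n + 1) r i =
      ((-1) ^ r.toNat * qprod q (i - r + 1) r) • (pathA K i * g q n r (i + 1)) +
        ((-1 : K) ^ r.toNat) • (pathAbar K (i - 1) * g q n (r - 1) (i - 1)) := by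
  induction n generalizing r i with
  | zero =>
    rw [g_succ, g, g, g, g]
    by_cases h0 : r = 0
    · subst h0
      rw [show i + ((0 + 1 : ℕ) : ZMod m) - 2 * ((0 : ℤ) : ZMod m) - 1 = i by push_cast; ring]
      simp [qprod_of_nonpos, pathA, triv_mul_ofArrow, ofArrow_mul_triv]
    · by_cases h1 : r = 1
      · subst h1
        rw [show i + ((0 + 1 : ℕ) : ZMod m) - 2 * ((1 : ℤ) : ZMod m) = i - 1 by push_cast; ring]
        simp [qprod_of_nonpos, pathAbar, triv_mul_ofArrow, ofArrow_mul_triv]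
      · simp [h0, show r - 1 ≠ 0 by omega]
  | succ n ih =>
    -- Both sides become sums of four terms with one arrow stripped from each end. The terms ending
    -- in an arrow a agree at once; the a…ā term needs `qprod_mul_qprod`, and the ā…ā term only a
    -- sign.
    rw [g_succ q (n + 1), ih r i, ih (r - 1) i, g_succ q n r (i + 1), g_succ q n (r - 1) (i - 1)]
    simp only [mul_add, add_mul, smul_add, mul_smul_comm, smul_mul_assoc, smul_smul, mul_assoc]
    rw [show i + 1 + ((n + 1 : ℕ) : ZMod m) - 2 * (r : ZMod m) =
        i + ((n + 1 + 1 : ℕ) : ZMod m) - 2 * (r : ZMod m) by push_cast; ring,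
      show i - 1 + ((n + 1 : ℕ) : ZMod m) - 2 * ((r - 1 : ℤ) : ZMod m) =
        i + ((n + 1 + 1 : ℕ) : ZMod m) - 2 * (r : ZMod m) by push_cast; ring,
      show i - 1 - ((r - 1 : ℤ) : ZMod m) + 1 = i - r + 1 by push_cast; ring,
      show ((n + 1 : ℕ) : ℤ) - (r - 1) = ((n + 1 + 1 : ℕ) : ℤ) - r by push_cast; ring,
      add_add_add_comm]
    congr 2
    · by_cases h : 1 ≤ r ∧ r ≤ n + 1
      · have := qprod_mul_qprod q i h.1 h.2
        rw [neg_one_pow_toNat h.1, show ((n + 1 + 1 : ℕ) : ℤ) - r = (n : ℤ) + 1 + 1 - r by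
          push_cast; ring, show ((n + 1 : ℕ) : ℤ) - r = (n : ℤ) + 1 - r by push_cast; ring]
        congr 1
        linear_combination (-1) ^ (n + 1 + 1) * (-1) ^ (r - 1).toNat * this
      · rw [g_eq_zero q n (r - 1) _ (by omega)]
        simp
    · by_cases h : 1 ≤ r
      · rw [neg_one_pow_toNat h]
        congr 1
        ring
      · rw [g_eq_zero q n (r - 1 - 1) _ (by omega)]
        simp

theorem isUniform_g (n : ℕ) (r : ℤ) (i : ZMod m) (h0 : 0 ≤ r) (h1 : r ≤ n) :
    (g q n r i).IsUniform i (i + n - 2 * r) :=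
  ⟨g_ne_zero q n r i h0 h1, triv_mul_g q n r i, g_mul_triv q n r i⟩

end DeformedCycle

/-! ### Representations of the path algebra -/

namespace PathAlgebra

variable {K : Type*} [Field K] {V : Type*} [Quiver V] {A : Type*} [Ring A] [Algebra K A]

/-- The value on a path of a representation given by the values `E` on the vertices and `F` on
the arrows. -/
def evalPath (E : V → A) (F : ∀ {i j : V}, (i ⟶ j) → A) {i : V} : ∀ {j : V}, Quiver.Path i j → A
  | _, .nil => E i
  | _, .cons p f => evalPath E F p * F f

section

variable [DecidableEq V] {E : V → A} {F : ∀ {i j : V}, (i ⟶ j) → A}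
  (hE : ∀ i j, E i * E j = if i = j then E i else 0)
  (hl : ∀ {i j : V} (f : i ⟶ j) k, E k * F f = if k = i then F f else 0)
  (hr : ∀ {i j : V} (f : i ⟶ j) k, F f * E k = if k = j then F f else 0)

include hE hl in
theorem mul_evalPath {i j : V} (p : Quiver.Path i j) (k : V) :
    E k * evalPath E F p = if k = i then evalPath E F p else 0 := by
  induction p with
  | nil =>
    rw [evalPath, hE]
    split_ifs with h
    · rw [h]
    · rfl
  | cons p f ih =>
    rw [evalPath, ← mul_assoc, ih]
    split_ifs
    · rfl
    · rw [zero_mul]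

include hE hr in
theorem evalPath_mul {i j : V} (p : Quiver.Path i j) :
    evalPath E F p * E j = evalPath E F p := by
  cases p with
  | nil => rw [evalPath, hE, if_pos rfl]
  | cons p f => rw [evalPath, mul_assoc, hr, if_pos rfl]

include hE hr in
theorem evalPath_comp {i j k : V} (p : Quiver.Path i j) (p' : Quiver.Path j k) :
    evalPath E F (p.comp p') = evalPath E F p * evalPath E F p' := by
  induction p' with
  | nil => exact (evalPath_mul hE hr p).symm
  | cons p' f ih => rw [Quiver.Path.comp_cons, evalPath, evalPath, ih, mul_assoc]

/-- The algebra homomorphism on the path algebra given by orthogonal idempotents for the vertices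
and compatible elements for the arrows. -/
def eval [Fintype V] (h1 : ∑ i, E i = 1) : PathAlgebra K V →+* A where
  toFun := extend (K := K) fun p => evalPath E F p.2.2
  map_zero' := map_zero _
  map_add' := map_add _
  map_one' := by
    rw [one_def, map_sum, ← h1]
    exact Finset.sum_congr rfl fun i _ => extend_ofPath _ _
  map_mul' x y := by
    induction x using PathAlgebra.induction_on with
    | zero => simp only [map_zero, zero_mul]
    | add x x' hx hx' => simp only [map_add, add_mul, hx, hx']
    | smul c p =>
      induction y using PathAlgebra.induction_on with
      | zero => simp only [map_zero, mul_zero]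
      | add y y' hy hy' => simp only [map_add, mul_add, hy, hy']
      | smul d p' =>
        obtain ⟨i, j, p⟩ := p
        obtain ⟨j', k, p'⟩ := p'
        simp only [map_smul, smul_mul_assoc, mul_smul_comm]
        congr 2
        by_cases h : j = j'
        · subst h
          rw [ofPath_mul_ofPath_of_eq, extend_ofPath, extend_ofPath, extend_ofPath]
          exact evalPath_comp hE hr p p'
        · rw [ofPath_mul_ofPath_of_ne K h, extend_ofPath, extend_ofPath, map_zero,
            ← evalPath_mul hE hr p, mul_assoc, mul_evalPath hE hl, if_neg h, mul_zero]

theorem eval_ofPath [Fintype V] (h1 : ∑ i, E i = 1) {i j : V} (p : Quiver.Path i j) :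
    eval (K := K) hE hl hr h1 (ofPath K ⟨i, j, p⟩) = evalPath E F p :=
  extend_ofPath _ _

theorem eval_ofArrow [Fintype V] (h1 : ∑ i, E i = 1) {i j : V} (f : i ⟶ j) :
    eval (K := K) hE hl hr h1 (ofArrow K f) = F f := by
  rw [ofArrow, eval_ofPath]
  exact (hl f i).trans (if_pos rfl)

theorem eval_smul [Fintype V] (h1 : ∑ i, E i = 1) (c : K) (x : PathAlgebra K V) :
    eval (K := K) hE hl hr h1 (c • x) = c • eval (K := K) hE hl hr h1 x :=
  map_smul (extend (K := K) fun p : APath V => evalPath E F p.2.2) c x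

end

end PathAlgebra

namespace DeformedCycle

open PathAlgebra

/-! ### The left regular representation of Λ_q -/

section

variable (K : Type*) [Field K] (m : ℕ)

/-- The vector space underlying the regular representation: the coordinates with first index
`0, 1, 2, 3` are those at `e_k`, `a_k`, `ā_k` and `a_k ā_k`. -/
abbrev RegRep := Fin 4 → ZMod m → K

end

variable {K : Type*} [Field K] {m : ℕ} [NeZero m] (q : ZMod m → Kˣ)

section

/-- The origin of a basis path. -/
def origin (t : Fin 4) (k : ZMod m) : ZMod m := if t = 2 then k + 1 else k

variable (K) in
/-- The action of `e_i` on the regular representation. -/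
def actE (i : ZMod m) : Module.End K (RegRep K m) where
  toFun v t k := if origin t k = i then v t k else 0
  map_add' v w := by
    ext t k
    simp only [Pi.add_apply]
    split_ifs <;> simp
  map_smul' c v := by
    ext t k
    simp

variable (K) in
/-- The action of `a_i` on the regular representation. -/
def actA (i : ZMod m) : Module.End K (RegRep K m) where
  toFun v := ![0, fun k => if k = i then v 0 (i + 1) else 0, 0,
    fun k => if k = i then v 2 i else 0]
  map_add' v w := by
    ext t k
    fin_cases t <;> by_cases h : k = i <;> simp [h]
  map_smul' c v := by
    ext t k
    fin_cases t <;> simp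

/-- The action of `ā_i` on the regular representation. -/
def actAbar (i : ZMod m) : Module.End K (RegRep K m) where
  toFun v := ![0, 0, fun k => if k = i then v 0 i else 0,
    fun k => if k = i + 1 then q (i + 1) * v 1 i else 0]
  map_add' v w := by
    ext t k
    fin_cases t <;> simp
    · by_cases h : k = i <;> simp [h]
    · by_cases h : k = i + 1 <;> simp [h, mul_add]
  map_smul' c v := by
    ext t k
    fin_cases t <;> simp [mul_left_comm]

/-- The action of an arrow on the regular representation. -/
def actArrow {i j : ZMod m} (f : i ⟶ j) : Module.End K (RegRep K m) :=
  match f with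
  | Arrow.a i => actA K i
  | Arrow.abar i => actAbar q i

theorem actE_mul_actE (i j : ZMod m) :
    actE K i * actE K j = if i = j then actE K i else 0 := by
  refine LinearMap.ext fun v => funext fun t => funext fun k => ?_
  by_cases h : i = j
  · subst h
    simp only [Module.End.mul_apply, actE, LinearMap.coe_mk, AddHom.coe_mk, if_true]
    split_ifs <;> rfl
  · simp only [Module.End.mul_apply, actE, LinearMap.coe_mk, AddHom.coe_mk, if_neg h]
    split_ifs with h1 h2
    · exact absurd (h1.symm.trans h2) h
    · rfl
    · rfl

theorem actE_mul_actArrow {i j : ZMod m} (f : i ⟶ j) (k : ZMod m) :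
    actE K k * actArrow q f = if k = i then actArrow q f else 0 := by
  refine LinearMap.ext fun v => funext fun t => funext fun l => ?_
  change Arrow m i j at f
  cases f
  · by_cases h : k = i
    · fin_cases t <;> simp +contextual [actE, actArrow, actA, origin, h]
    · fin_cases t <;> simp +contextual [actE, actArrow, actA, origin, h]
  · by_cases h : k = j + 1
    · fin_cases t <;> simp +contextual [actE, actArrow, actAbar, origin, h]
    · fin_cases t <;> simp +contextual [actE, actArrow, actAbar, origin, h]
      exact fun h1 h2 => absurd (by rw [← h1, h2]) h

theorem actArrow_mul_actE {i j : ZMod m} (f : i ⟶ j) (k : ZMod m) :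
    actArrow q f * actE K k = if k = j then actArrow q f else 0 := by
  refine LinearMap.ext fun v => funext fun t => funext fun l => ?_
  change Arrow m i j at f
  cases f
  · by_cases h : k = i + 1
    · fin_cases t <;> simp [actE, actArrow, actA, origin, h]
    · fin_cases t <;> simp [actE, actArrow, actA, origin, h, Ne.symm h]
  · by_cases h : k = j
    · fin_cases t <;> simp [actE, actArrow, actAbar, origin, h]
    · fin_cases t <;> simp [actE, actArrow, actAbar, origin, h, Ne.symm h]

variable (K) in
theorem sum_actE : ∑ i : ZMod m, actE K i = 1 := by
  refine LinearMap.ext fun v => funext fun t => funext fun k => ?_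
  simp [LinearMap.sum_apply, actE]

/-- The regular representation of the path algebra. -/
def pathRep : PathAlgebra K (ZMod m) →+* Module.End K (RegRep K m) :=
  eval (K := K) actE_mul_actE (actE_mul_actArrow q) (actArrow_mul_actE q) (sum_actE K)

theorem pathRep_ofPath {i j : ZMod m} (p : Quiver.Path i j) :
    pathRep q (ofPath K ⟨i, j, p⟩) = evalPath (actE K) (actArrow q) p :=
  eval_ofPath actE_mul_actE (actE_mul_actArrow q) (actArrow_mul_actE q) (sum_actE K) p

theorem pathRep_smul (c : K) (x : PathAlgebra K (ZMod m)) :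
    pathRep q (c • x) = c • pathRep q x :=
  eval_smul actE_mul_actE (actE_mul_actArrow q) (actArrow_mul_actE q) (sum_actE K) c x

theorem pathRep_pathA (i : ZMod m) : pathRep q (pathA K i) = actA K i :=
  eval_ofArrow actE_mul_actE (actE_mul_actArrow q) (actArrow_mul_actE q) (sum_actE K) (Arrow.a i)

theorem pathRep_pathAbar (i : ZMod m) : pathRep q (pathAbar K i) = actAbar q i :=
  eval_ofArrow actE_mul_actE (actE_mul_actArrow q) (actArrow_mul_actE q) (sum_actE K)
    (Arrow.abar i)

theorem pathRep_relations (x : PathAlgebra K (ZMod m)) (hx : x ∈ relations q) :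
    pathRep q x = 0 := by
  obtain ⟨i, rfl | rfl | rfl⟩ := hx
  · rw [map_mul, pathRep_pathA, pathRep_pathA]
    refine LinearMap.ext fun v => funext fun t => funext fun k => ?_
    fin_cases t <;> simp [actA]
  · rw [map_mul, pathRep_pathAbar, pathRep_pathAbar]
    refine LinearMap.ext fun v => funext fun t => funext fun k => ?_
    fin_cases t <;> simp [actAbar]
  -- The factor q(i + 1) built into `actAbar` is exactly what this relation demands.
  · rw [map_sub, pathRep_smul, map_mul, map_mul, pathRep_pathA, pathRep_pathA, pathRep_pathAbar,
      pathRep_pathAbar]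
    refine LinearMap.ext fun v => funext fun t => funext fun k => ?_
    fin_cases t <;> simp [actA, actAbar]

/-- The regular representation of `Λ_q`. -/
def rep : Lam q →+* Module.End K (RegRep K m) :=
  (TwoSidedIdeal.span (relations q)).ringCon.lift (pathRep q) fun x y h => by
    have hle : TwoSidedIdeal.span (relations q) ≤ TwoSidedIdeal.ker (pathRep q) :=
      TwoSidedIdeal.span_le.mpr fun x hx =>
        (TwoSidedIdeal.mem_ker _).mpr (pathRep_relations q x hx)
    have := hle ((TwoSidedIdeal.rel_iff _ x y).mp h)
    rw [TwoSidedIdeal.mem_ker, map_sub, sub_eq_zero] at this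
    exact this

theorem rep_proj (x : PathAlgebra K (ZMod m)) : rep q (proj q x) = pathRep q x := rfl

theorem proj_surjective : Function.Surjective (proj q) := RingCon.mk'_surjective _

theorem proj_smul (c : K) (x : PathAlgebra K (ZMod m)) : proj q (c • x) = c • proj q x := rfl

theorem rep_e (i : ZMod m) : rep q (e q i) = actE K i := pathRep_ofPath q _

theorem rep_a (i : ZMod m) : rep q (a q i) = actA K i := pathRep_pathA q i

theorem rep_abar (i : ZMod m) : rep q (abar q i) = actAbar q i := pathRep_pathAbar q i

theorem rep_smul (c : K) (x : Lam q) : rep q (c • x) = c • rep q x := by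
  obtain ⟨x, rfl⟩ := proj_surjective q x
  exact pathRep_smul q c x

end

/-! ### The multiplication table of Λ_q -/

section

variable (i j : ZMod m)

theorem e_mul_e_eq : e q i * e q j = if i = j then e q i else 0 := by
  rw [e, e, ← map_mul, triv_mul_triv]
  split_ifs
  · rfl
  · exact map_zero _

theorem e_mul_a_eq : e q i * a q j = if i = j then a q j else 0 := by
  rw [e, a, ← map_mul, pathA, triv_mul_ofArrow]
  split_ifs
  · rfl
  · exact map_zero _

theorem a_mul_e_eq : a q i * e q j = if j = i + 1 then a q i else 0 := by
  rw [e, a, ← map_mul, pathA, ofArrow_mul_triv]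
  split_ifs
  · rfl
  · exact map_zero _

theorem e_mul_abar_eq : e q i * abar q j = if i = j + 1 then abar q j else 0 := by
  rw [e, abar, ← map_mul, pathAbar, triv_mul_ofArrow]
  split_ifs
  · rfl
  · exact map_zero _

theorem abar_mul_e_eq : abar q i * e q j = if j = i then abar q i else 0 := by
  rw [e, abar, ← map_mul, pathAbar, ofArrow_mul_triv]
  split_ifs
  · rfl
  · exact map_zero _

theorem sum_e : ∑ i, e q i = 1 := by
  simp only [e, ← map_sum]
  exact map_one (proj q)

theorem proj_relations {x : PathAlgebra K (ZMod m)} (hx : x ∈ relations q) : proj q x = 0 := by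
  have h := TwoSidedIdeal.subset_span hx
  rwa [SetLike.mem_coe, ← TwoSidedIdeal.ker_ringCon_mk' (TwoSidedIdeal.span (relations q)),
    TwoSidedIdeal.mem_ker] at h

theorem a_mul_a : a q i * a q j = 0 := by
  by_cases h : j = i + 1
  · subst h
    exact (map_mul (proj q) _ _).symm.trans (proj_relations q ⟨i, Or.inl rfl⟩)
  · rw [← e_mul_a q j, ← mul_assoc, a_mul_e_eq, if_neg h, zero_mul]

theorem abar_mul_abar : abar q i * abar q j = 0 := by
  by_cases h : i = j + 1
  · subst h
    refine (map_mul (proj q) _ _).symm.trans (proj_relations q ⟨j + 2, Or.inr (Or.inl ?_)⟩)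
    rw [show j + 2 - 1 = j + 1 by ring, add_sub_cancel_right]
  · rw [← abar_mul_e, mul_assoc, e_mul_abar_eq, if_neg h, mul_zero]

/-- The element `a_i ā_i` of the socle of `Λ_q`. -/
def soc : Lam q := a q i * abar q i

theorem abar_mul_a_self : abar q i * a q i = (q (i + 1) : K) • soc q (i + 1) := by
  have := proj_relations q (x := (q (i + 1) : K) • (pathA K (i + 1) * pathAbar K (i + 1)) -
    pathAbar K (i + 1 - 1) * pathA K (i + 1 - 1)) ⟨i + 1, Or.inr (Or.inr rfl)⟩
  rw [map_sub, proj_smul, map_mul, map_mul, sub_eq_zero, add_sub_cancel_right] at this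
  exact this.symm

theorem a_mul_abar : a q i * abar q j = if i = j then soc q i else 0 := by
  split_ifs with h
  · rw [h, soc]
  · rw [← a_mul_e q i (i + 1) rfl, mul_assoc, e_mul_abar_eq, if_neg (by simpa using h), mul_zero]

theorem abar_mul_a :
    abar q i * a q j = if i = j then (q (i + 1) : K) • soc q (i + 1) else 0 := by
  split_ifs with h
  · rw [← abar_mul_a_self, h]
  · rw [← abar_mul_e, mul_assoc, e_mul_a_eq, if_neg h, mul_zero]

theorem e_mul_soc : e q i * soc q j = if i = j then soc q j else 0 := by
  rw [soc, ← mul_assoc, e_mul_a_eq, ite_mul, zero_mul]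

theorem soc_mul_e : soc q i * e q j = if j = i then soc q i else 0 := by
  rw [soc, mul_assoc, abar_mul_e_eq, mul_ite, mul_zero]

theorem a_mul_soc : a q i * soc q j = 0 := by rw [soc, ← mul_assoc, a_mul_a, zero_mul]

theorem soc_mul_abar : soc q i * abar q j = 0 := by rw [soc, mul_assoc, abar_mul_abar, mul_zero]

/-- Up to the unit q_i the socle element is also ā_{i-1} a_{i-1}, and aa = 0. -/
theorem soc_mul_a : soc q i * a q j = 0 := by
  have h : abar q (i - 1) * a q (i - 1) * a q j = 0 := by rw [mul_assoc, a_mul_a, mul_zero]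
  rw [abar_mul_a_self, sub_add_cancel, smul_mul_assoc] at h
  exact (smul_eq_zero_iff_right (q i).ne_zero).mp h

theorem abar_mul_soc : abar q i * soc q j = 0 := by
  rw [soc, ← mul_assoc, abar_mul_a, ite_mul, smul_mul_assoc, soc_mul_abar, smul_zero, zero_mul,
    ite_self]

/-- An arrow of the quiver, as an element of `Λ_q`. -/
def IsArrow (x : Lam q) : Prop := ∃ i, x = a q i ∨ x = abar q i

theorem isArrow_a : IsArrow q (a q i) := ⟨i, Or.inl rfl⟩

theorem isArrow_abar : IsArrow q (abar q i) := ⟨i, Or.inr rfl⟩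

/-- The radical has cube zero: this nilpotency drives both the Nakayama lemma and the exactness
argument. -/
theorem arrow_mul_arrow_mul_arrow {x y z : Lam q} (hx : IsArrow q x) (hy : IsArrow q y)
    (hz : IsArrow q z) : x * y * z = 0 := by
  obtain ⟨i, rfl | rfl⟩ := hx <;> obtain ⟨j, rfl | rfl⟩ := hy <;> obtain ⟨k, rfl | rfl⟩ := hz <;>
    simp only [a_mul_a, abar_mul_abar, zero_mul, a_mul_abar, abar_mul_a, ite_mul, smul_mul_assoc,
      soc_mul_a, soc_mul_abar, ite_self, smul_zero]

end

/-! ### A basis of Λ_q -/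

section

/-- The element of `Λ_q` with given coordinates. -/
def ofCoords : RegRep K m →ₗ[K] Lam q where
  toFun v := ∑ k : ZMod m, (v 0 k • e q k + v 1 k • a q k + v 2 k • abar q k + v 3 k • soc q k)
  map_add' v w := by
    rw [← Finset.sum_add_distrib]
    refine Finset.sum_congr rfl fun k _ => ?_
    simp only [Pi.add_apply]
    module
  map_smul' c v := by
    simp [Finset.smul_sum, smul_smul]

theorem ofCoords_apply (v : RegRep K m) : ofCoords q v =
    ∑ k : ZMod m, (v 0 k • e q k + v 1 k • a q k + v 2 k • abar q k + v 3 k • soc q k) := rfl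

theorem ofCoords_actE (i : ZMod m) (v : RegRep K m) :
    ofCoords q (actE K i v) = e q i * ofCoords q v := by
  simp only [ofCoords_apply, Finset.mul_sum, mul_add, mul_smul_comm, e_mul_e_eq, e_mul_a_eq,
    e_mul_abar_eq, e_mul_soc]
  refine Finset.sum_congr rfl fun k _ => ?_
  simp only [actE, LinearMap.coe_mk, AddHom.coe_mk, origin, eq_comm (a := i)]
  by_cases h : k = i
  · subst h
    simp
  · simp [h]

theorem ofCoords_actA (i : ZMod m) (v : RegRep K m) :
    ofCoords q (actA K i v) = a q i * ofCoords q v := by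
  simp only [ofCoords_apply, Finset.mul_sum, mul_add, mul_smul_comm, a_mul_e_eq, a_mul_a,
    smul_zero, add_zero, a_mul_abar, a_mul_soc]
  simp [actA, Finset.sum_add_distrib]

theorem ofCoords_actAbar (i : ZMod m) (v : RegRep K m) :
    ofCoords q (actAbar q i v) = abar q i * ofCoords q v := by
  simp only [ofCoords_apply, Finset.mul_sum, mul_add, mul_smul_comm, abar_mul_e_eq, abar_mul_abar,
    abar_mul_a, abar_mul_soc, smul_zero, add_zero]
  simp [actAbar, Finset.sum_add_distrib, smul_smul, mul_comm]

theorem ofCoords_evalPath {i j : ZMod m} (p : Quiver.Path i j) (v : RegRep K m) :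
    ofCoords q (evalPath (actE K) (actArrow q) p v) =
      proj q (ofPath K ⟨i, j, p⟩) * ofCoords q v := by
  induction p generalizing v with
  | nil => exact ofCoords_actE q i v
  | cons p f ih =>
    rw [evalPath, Module.End.mul_apply, ih, ← ofPath_mul_ofArrow, map_mul, mul_assoc]
    congr 1
    change Arrow m _ _ at f
    cases f
    · exact ofCoords_actA q _ v
    · exact ofCoords_actAbar q _ v

/-- Left linearity of `ofCoords` is what shows that the four families span: evaluation at the
coordinates of 1 then recovers every x. -/
theorem ofCoords_rep (x : Lam q) (v : RegRep K m) :
    ofCoords q (rep q x v) = x * ofCoords q v := by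
  obtain ⟨x, rfl⟩ := proj_surjective q x
  rw [rep_proj]
  induction x using PathAlgebra.induction_on with
  | zero => simp
  | add x y hx hy => simp only [map_add, LinearMap.add_apply, add_mul, hx, hy]
  | smul c p =>
    obtain ⟨i, j, p⟩ := p
    rw [proj_smul, pathRep_smul, LinearMap.smul_apply, map_smul, smul_mul_assoc, pathRep_ofPath,
      ofCoords_evalPath]

/-- The coordinates of an element of `Λ_q`. -/
def coords : Lam q →ₗ[K] RegRep K m where
  -- The first entry is the constant function 1, so this vector stands for the sum of all e_k, the
  -- unit of Λ_q.
  toFun x := rep q x ![1, 0, 0, 0]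
  map_add' x y := by rw [map_add, LinearMap.add_apply]
  map_smul' c x := by rw [rep_smul]; rfl

theorem ofCoords_coords (x : Lam q) : ofCoords q (coords q x) = x := by
  refine (ofCoords_rep q x _).trans ?_
  rw [ofCoords_apply]
  simp [sum_e]

theorem coords_e (i : ZMod m) : coords q (e q i) = ![Pi.single i 1, 0, 0, 0] := by
  change rep q (e q i) _ = _
  rw [rep_e]
  ext t k
  fin_cases t <;> simp [actE, Pi.single_apply, origin]

theorem coords_a (i : ZMod m) : coords q (a q i) = ![0, Pi.single i 1, 0, 0] := by
  change rep q (a q i) _ = _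
  rw [rep_a]
  ext t k
  fin_cases t <;> simp [actA, Pi.single_apply]

theorem coords_abar (i : ZMod m) : coords q (abar q i) = ![0, 0, Pi.single i 1, 0] := by
  change rep q (abar q i) _ = _
  rw [rep_abar]
  ext t k
  fin_cases t <;> simp [actAbar, Pi.single_apply]

theorem coords_soc (i : ZMod m) : coords q (soc q i) = ![0, 0, 0, Pi.single i 1] := by
  change rep q (a q i * abar q i) _ = _
  rw [map_mul, rep_a, rep_abar]
  ext t k
  fin_cases t <;> simp [actA, actAbar, Pi.single_apply]

/-- The decomposition of the elements of `Λ_q e_i`. -/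
theorem mul_e_eq (x : Lam q) (i : ZMod m) :
    x * e q i = coords q x 0 i • e q i + coords q x 1 (i - 1) • a q (i - 1) +
      coords q x 2 i • abar q i + coords q x 3 i • soc q i := by
  conv_lhs => rw [← ofCoords_coords q x, ofCoords_apply]
  simp only [Finset.sum_mul, add_mul, smul_mul_assoc, e_mul_e_eq, a_mul_e_eq, abar_mul_e_eq,
    soc_mul_e, Finset.sum_add_distrib, ← sub_eq_iff_eq_add, smul_ite, smul_zero]
  simp

end

/-! ### The bimodules P^n and their generators -/

theorem env_induction {p : Env q → Prop} (zero : p 0) (add : ∀ z w, p z → p w → p (z + w))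
    (tens : ∀ x y, p (tens q x y)) (z : Env q) : p z :=
  TensorProduct.induction_on (motive := p) z zero (fun x y => tens x y.unop) add

instance (n : ℕ) : Module K (P q n) := Module.compHom _ (algebraMap K (Env q))

instance (n : ℕ) : IsScalarTower K (Env q) (P q n) where
  smul_assoc c z v := by
    rw [Algebra.smul_def, mul_smul]
    rfl

section

variable (x y : Lam q)

theorem lmul_mul_lmul : lmul q x * lmul q y = lmul q (x * y) := by
  rw [lmul, lmul, lmul, tens_mul_tens, mul_one]

theorem rmul_mul_rmul : rmul q x * rmul q y = rmul q (y * x) := by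
  rw [rmul, rmul, rmul, tens_mul_tens, mul_one]

theorem rmul_mul_lmul : rmul q y * lmul q x = tens q x y := by
  rw [lmul, rmul, tens_mul_tens, one_mul, one_mul]

theorem lmul_mul_rmul : lmul q x * rmul q y = tens q x y := by
  rw [lmul, rmul, tens_mul_tens, mul_one, mul_one]

theorem lmul_add : lmul q (x + y) = lmul q x + lmul q y := TensorProduct.add_tmul _ _ _

theorem rmul_add : rmul q (x + y) = rmul q x + rmul q y := TensorProduct.tmul_add _ _ _

theorem lmul_smul (c : K) : lmul q (c • x) = c • lmul q x := rfl

theorem rmul_smul (c : K) : rmul q (c • x) = c • rmul q x :=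
  TensorProduct.tmul_smul c (1 : Lam q) (op x)

theorem lmul_zero : lmul q 0 = 0 := TensorProduct.zero_tmul _ _

theorem rmul_zero : rmul q 0 = 0 := TensorProduct.tmul_zero _ _

theorem lmul_one : lmul q 1 = 1 := rfl

theorem rmul_one : rmul q 1 = 1 := rfl

variable {M : Type*} [AddCommGroup M] [Module (Env q) M] (v : M)

theorem lmul_smul_lmul_smul : lmul q x • lmul q y • v = lmul q (x * y) • v := by
  rw [← mul_smul, lmul_mul_lmul]

theorem rmul_smul_rmul_smul : rmul q x • rmul q y • v = rmul q (y * x) • v := by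
  rw [← mul_smul, rmul_mul_rmul]

theorem lmul_smul_rmul_smul : lmul q x • rmul q y • v = rmul q y • lmul q x • v := by
  rw [← mul_smul, ← mul_smul, rmul_mul_lmul, lmul_mul_rmul]

theorem lmul_smul_lam (z : Lam q) : lmul q x • z = x * z := by
  rw [lmul, tens_smul, mul_one]

theorem rmul_smul_lam (z : Lam q) : rmul q x • z = z * x := by
  rw [rmul, tens_smul, one_mul]

end

theorem map_smul_env {n : ℕ} {M : Type*} [AddCommGroup M] [Module K M] [Module (Env q) M]
    [IsScalarTower K (Env q) M] (f : P q n →ₗ[Env q] M) (c : K) (v : P q n) :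
    f (c • v) = c • f v := LinearMap.map_smul_of_tower f c v

instance : IsScalarTower K (Env q) (Lam q) where
  smul_assoc c z v := by
    induction z using env_induction with
    | zero => rw [smul_zero, zero_smul, smul_zero]
    | add x y hx hy => rw [smul_add, add_smul, add_smul, smul_add, ← hx, ← hy]
    | tens x y =>
      change tens q (c • x) y • v = c • (tens q x y • v)
      rw [tens_smul, tens_smul, smul_mul_assoc, smul_mul_assoc]

theorem gen_eq_zero (n : ℕ) (r : ℤ) (i : ZMod m) (h : r < 0 ∨ n < r) : gen q n r i = 0 :=
  dif_neg (by omega)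

theorem idem_smul_gen (n : ℕ) (r : ℤ) (i : ZMod m) :
    idem q i (i + n - 2 * r) • gen q n r i = gen q n r i := by
  conv_rhs => rw [← one_smul (Env q) (gen q n r i)]
  refine smul_gen q rfl ?_
  rw [one_mul, idem, tens_mul_tens, e_mul_e, e_mul_e]

theorem lmul_e_smul_gen (n : ℕ) (r : ℤ) (i : ZMod m) :
    lmul q (e q i) • gen q n r i = gen q n r i := by
  conv_lhs => rw [← idem_smul_gen, ← mul_smul, lmul, idem, tens_mul_tens, e_mul_e, mul_one]
  exact idem_smul_gen q n r i

theorem rmul_e_smul_gen {n : ℕ} {r : ℤ} {i j : ZMod m} (hj : j = i + n - 2 * r) :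
    rmul q (e q j) • gen q n r i = gen q n r i := by
  subst hj
  conv_lhs => rw [← idem_smul_gen, ← mul_smul, rmul, idem, tens_mul_tens, e_mul_e, one_mul]
  exact idem_smul_gen q n r i

/-- The differential of a generator, with the scalars acting on the bimodule `P^k`. -/
theorem diffGen_eq {k : ℕ} {r : ℤ} {i j : ZMod m} (hj : j = i + (k + 1 : ℕ) - 2 * r) :
    diffGen q k r i =
      rmul q (a q (j - 1)) • gen q k r i +
      ((-1) ^ (k + 1) * qprod q (i - r + 1) ((k + 1 : ℕ) - r)) •
        rmul q (abar q j) • gen q k (r - 1) i +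
      ((-1) ^ (k + 1) * ((-1) ^ r.toNat * qprod q (i - r + 1) r)) •
        lmul q (a q i) • gen q k r (i + 1) +
      ((-1 : K) ^ (k + 1) * (-1) ^ r.toNat) •
        lmul q (abar q (i - 1)) • gen q k (r - 1) (i - 1) := by
  subst hj
  simp only [← smul_assoc]
  rfl

/-- Outside 0 ≤ r ≤ k + 1 the generator and all four terms of `diffGen` are zero, so the formula may
be iterated without treating boundary values of r. -/
theorem diff_gen_eq {k : ℕ} {r : ℤ} {i : ZMod m} :
    diff q k (gen q (k + 1) r i) = diffGen q k r i := by
  by_cases h : 0 ≤ r ∧ r ≤ (k + 1 : ℕ)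
  · exact diff_gen q k r i h.1 h.2
  · rw [gen_eq_zero q _ _ _ (by omega), map_zero, diffGen_eq q rfl,
      gen_eq_zero q k r i (by push_cast at h; omega),
      gen_eq_zero q k r (i + 1) (by push_cast at h; omega),
      gen_eq_zero q k (r - 1) i (by push_cast at h; omega),
      gen_eq_zero q k (r - 1) (i - 1) (by push_cast at h; omega)]
    simp

theorem gen_induction {n : ℕ} {p : P q n → Prop} (zero : p 0)
    (add : ∀ v w, p v → p w → p (v + w))
    (gen : ∀ r i x y, 0 ≤ r → r ≤ (n : ℤ) → p (rmul q y • lmul q x • gen q n r i))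
    (v : P q n) : p v := by
  refine DirectSum.induction_on (motive := p) v zero ?_ add
  rintro ⟨i, r⟩ ⟨z, hz⟩
  obtain ⟨w, rfl⟩ := Submodule.mem_span_singleton.mp hz
  have key : (DirectSum.of (fun s : ZMod m × Fin (n + 1) =>
      summand q s.1 (s.1 + n - 2 * (s.2 : ℕ))) (i, r) ⟨w • idem q i (i + n - 2 * (r : ℕ)), hz⟩ :
      P q n) = w • DeformedCycle.gen q n (r : ℕ) i := by
    rw [DeformedCycle.gen, dif_pos ⟨by omega, by omega⟩]
    exact map_smul (incl q n (i, r)) w ⟨idem q i (i + n - 2 * (r : ℕ)), _⟩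
  change p (DirectSum.of (fun s : ZMod m × Fin (n + 1) =>
      summand q s.1 (s.1 + n - 2 * (s.2 : ℕ))) (i, r) ⟨w • idem q i (i + n - 2 * (r : ℕ)), hz⟩ :
      P q n)
  rw [key]
  clear key hz
  induction w using env_induction with
  | zero => rwa [zero_smul]
  | add x y hx hy =>
    rw [add_smul]
    exact add _ _ hx hy
  | tens x y =>
    rw [← rmul_mul_lmul, mul_smul]
    exact gen (r : ℕ) i x y (by omega) (by omega)

/-- The paths which form a basis of `Λ_q e_i`. -/
inductive IsBasisPath (i : ZMod m) : Lam q → Prop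
  | e : IsBasisPath i (e q i)
  | a : IsBasisPath i (a q (i - 1))
  | abar : IsBasisPath i (abar q i)
  | soc : IsBasisPath i (soc q i)

/-- The left factor can be expanded in the basis; its coefficients are absorbed by the arbitrary
right factor y, so the motive need not respect scalars. -/
theorem basisPath_induction {n : ℕ} {p : P q n → Prop} (zero : p 0)
    (add : ∀ v w, p v → p w → p (v + w))
    (gen : ∀ r i x y, 0 ≤ r → r ≤ (n : ℤ) → IsBasisPath q i x →
      p (rmul q y • lmul q x • gen q n r i))
    (v : P q n) : p v := by
  refine gen_induction q zero add (fun r i x y h0 h1 => ?_) v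
  have key (c : K) (x : Lam q) (hx : IsBasisPath q i x) :
      p (rmul q y • lmul q (c • x) • DeformedCycle.gen q n r i) := by
    have := gen r i x (c • y) h0 h1 hx
    rwa [rmul_smul, smul_assoc, smul_comm, ← smul_assoc c, ← lmul_smul] at this
  rw [← lmul_e_smul_gen, lmul_smul_lmul_smul, mul_e_eq, lmul_add, lmul_add, lmul_add, add_smul,
    add_smul, add_smul, smul_add, smul_add, smul_add]
  exact add _ _ (add _ _ (add _ _ (key _ _ .e) (key _ _ .a)) (key _ _ .abar)) (key _ _ .soc)

/-! ### The composites of consecutive maps vanish -/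

theorem hom_ext {n : ℕ} {M : Type*} [AddCommGroup M] [Module (Env q) M] {f g : P q n →ₗ[Env q] M}
    (h : ∀ r i, 0 ≤ r → r ≤ (n : ℤ) → f (gen q n r i) = g (gen q n r i)) : f = g := by
  refine LinearMap.ext fun v => ?_
  induction v using gen_induction with
  | zero => rw [map_zero, map_zero]
  | add v w hv hw => rw [map_add, map_add, hv, hw]
  | gen r i x y h0 h1 => simp only [map_smul, h r i h0 h1]

theorem diff_comp_diff (k : ℕ) : diff q k ∘ₗ diff q (k + 1) = 0 := by
  refine hom_ext q fun r i _ _ => ?_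
  obtain ⟨j, hj⟩ : ∃ j, j = i + (k + 1 + 1 : ℕ) - 2 * (r : ZMod m) := ⟨_, rfl⟩
  rw [LinearMap.comp_apply, diff_gen_eq, diffGen_eq q hj, LinearMap.zero_apply]
  simp only [map_add, map_smul, map_smul_env, diff_gen_eq]
  rw [diffGen_eq q (k := k) (r := r) (i := i) (j := j - 1) (by rw [hj]; push_cast; ring),
    diffGen_eq q (k := k) (r := r - 1) (i := i) (j := j + 1) (by rw [hj]; push_cast; ring),
    diffGen_eq q (k := k) (r := r) (i := i + 1) (j := j) (by rw [hj]; push_cast; ring),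
    diffGen_eq q (k := k) (r := r - 1) (i := i - 1) (j := j) (by rw [hj]; push_cast; ring)]
  simp only [smul_add, smul_comm (rmul q _) (_ : K), smul_comm (lmul q _) (_ : K),
    lmul_smul_rmul_smul, lmul_smul_lmul_smul, rmul_smul_rmul_smul, add_sub_cancel_right,
    sub_add_cancel, a_mul_a, abar_mul_abar, a_mul_abar, abar_mul_a, if_true, lmul_zero, rmul_zero,
    zero_smul, smul_zero, add_zero, zero_add, lmul_smul, rmul_smul, smul_assoc]
  -- The end values of r are separated because `qprod` and `toNat` truncate there; the generators
  -- with an index out of range vanish instead.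
  by_cases h1 : 1 ≤ r
  swap
  · rw [gen_eq_zero q k (r - 1) i (by omega), gen_eq_zero q k (r - 1) (i - 1) (by omega),
      gen_eq_zero q k (r - 1) (i + 1) (by omega), gen_eq_zero q k (r - 1 - 1) (i - 1) (by omega)]
    simp only [smul_zero, add_zero, zero_add]
    -- The action of the enveloping algebra is hidden inside additive maps, so that `module` sees
    -- only scalars from K.
    simp only [← DistribSMul.toAddMonoidHom_apply (P q k) (_ : Env q)]
    module
  -- `hQ` cancels the two terms with a socle element on the left, `hR` those with one on the right,
  -- and `hP` the mixed terms with a on the left and ā on the right.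
  have hQ := qprod_add_one q (i - r + 1) (k := r - 1) (by omega)
  rw [sub_add_cancel, show i - (r : ZMod m) + 1 + ((r - 1 : ℤ) : ZMod m) = i by
    push_cast; ring] at hQ
  rw [neg_one_pow_toNat h1, show i - 1 - ((r - 1 : ℤ) : ZMod m) + 1 = i - r + 1 by push_cast; ring,
    show ((k + 1 : ℕ) : ℤ) - (r - 1) = ((k + 1 + 1 : ℕ) : ℤ) - r by push_cast; ring]
  by_cases h2 : r ≤ k + 1
  swap
  · rw [gen_eq_zero q k (r - 1) i (by omega),
      gen_eq_zero q k (r - 1) (i + 1) (by omega), gen_eq_zero q k r (i + 1) (by omega)]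
    simp only [smul_zero, add_zero, zero_add]
    simp only [← DistribSMul.toAddMonoidHom_apply (P q k) (_ : Env q)]
    module
  have hP := qprod_mul_qprod q i (n := k + 1) h1 h2
  have hR := qprod_add_one q (i - r + 1) (k := (k + 1 : ℕ) - r) (by push_cast; omega)
  rw [show i - (r : ZMod m) + 1 + ((((k + 1 : ℕ) : ℤ) - r : ℤ) : ZMod m) = j by
    rw [hj]; push_cast; ring] at hR
  rw [show (k + 1 : ℤ) + 1 - r = (k + 1 : ℕ) - r + 1 by push_cast; ring, hR, hQ,
    show (k + 1 : ℤ) - r = (k + 1 : ℕ) - r by push_cast; ring] at hP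
  rw [show ((k + 1 + 1 : ℕ) : ℤ) - r = (k + 1 : ℕ) - r + 1 by push_cast; ring, hR, hQ]
  simp only [← DistribSMul.toAddMonoidHom_apply (P q k) (_ : Env q)]
  push_cast at hP
  match_scalars
  · ring
  · ring
  · ring
  · linear_combination (-1) ^ (k + 1 + 1) * (-1) ^ (k + 1) * (-1) ^ (r - 1).toNat * hP
  · ring
  · ring

theorem aug_gen (i : ZMod m) : aug q (gen q 0 0 i) = e q i := by
  rw [gen, dif_pos ⟨le_rfl, le_rfl⟩, aug_incl q _ _ (e q i) (e q i), e_mul_e]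
  simp [idem]

theorem aug_comp_diff : aug q ∘ₗ diff q 0 = 0 := by
  refine hom_ext q fun r i h0 h1 => ?_
  rw [LinearMap.comp_apply, diff_gen_eq, diffGen_eq q rfl, LinearMap.zero_apply]
  simp only [map_add, map_smul, map_smul_env]
  obtain rfl | rfl : r = 0 ∨ r = 1 := by omega
  · rw [gen_eq_zero q 0 (0 - 1) _ (by omega), gen_eq_zero q 0 (0 - 1) _ (by omega), aug_gen,
      aug_gen, lmul_smul_lam, rmul_smul_lam, a_mul_e q _ _ rfl,
      show i + ((0 + 1 : ℕ) : ZMod m) - 2 * ((0 : ℤ) : ZMod m) - 1 = i by push_cast; ring, e_mul_a]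
    simp [qprod_of_nonpos]
  · rw [gen_eq_zero q 0 1 _ (by omega), gen_eq_zero q 0 1 _ (by omega), sub_self, aug_gen,
      aug_gen, lmul_smul_lam, rmul_smul_lam, map_zero,
      show i + ((0 + 1 : ℕ) : ZMod m) - 2 * ((1 : ℤ) : ZMod m) = i - 1 by push_cast; ring,
      rmul_smul_lam, lmul_smul_lam, abar_mul_e, e_mul_abar q _ _ (by ring)]
    simp [qprod_of_nonpos]

/-! ### Surjectivity of the augmentation and projectivity -/

theorem aug_surjective : Function.Surjective (aug q) := fun y =>
  ⟨rmul q y • ∑ i, gen q 0 0 i, by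
    rw [map_smul, map_sum]
    simp only [aug_gen, sum_e]
    rw [rmul_smul_lam, one_mul]⟩

/-- Right multiplication by the idempotent e_i ⊗ e_j retracts the enveloping algebra onto the left
ideal it generates. -/
theorem projective_summand (i j : ZMod m) : Module.Projective (Env q) (summand q i j) := by
  have hid : idem q i j * idem q i j = idem q i j := by
    rw [idem, tens_mul_tens, e_mul_e, e_mul_e]
  refine Module.Projective.of_split (summand q i j).subtype
    ((LinearMap.toSpanSingleton (Env q) (Env q) (idem q i j)).codRestrict (summand q i j)
      fun z => Submodule.smul_mem _ z (Submodule.mem_span_singleton_self _)) ?_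
  refine LinearMap.ext fun ⟨z, hz⟩ => Subtype.ext ?_
  obtain ⟨w, rfl⟩ := Submodule.mem_span_singleton.mp hz
  change (w * idem q i j) * idem q i j = w * idem q i j
  rw [mul_assoc, hid]

theorem projective_P (n : ℕ) : Module.Projective (Env q) (P q n) :=
  haveI := fun s : ZMod m × Fin (n + 1) =>
    projective_summand q s.1 (s.1 + n - 2 * (s.2 : ℕ))
  Module.Projective.directSum

theorem lam_induction {p : Lam q → Prop} (zero : p 0) (add : ∀ x y, p x → p y → p (x + y))
    (smul : ∀ (c : K) i x, IsBasisPath q i x → p (c • x)) (x : Lam q) : p x := by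
  rw [← mul_one x, ← sum_e, Finset.mul_sum]
  refine Finset.sum_induction _ p add zero fun i _ => ?_
  rw [mul_e_eq]
  exact add _ _ (add _ _ (add _ _ (smul _ i _ .e) (smul _ i _ .a)) (smul _ i _ .abar))
    (smul _ i _ .soc)

/-! ### One-sided radicals and nilpotency -/

section Radical

/-- The span of all products of elements of `P^n` with elements of a given subset of the
enveloping algebra. -/
def rad (S : Set (Env q)) (n : ℕ) : Submodule K (P q n) :=
  Submodule.span K {v | ∃ s ∈ S, ∃ w, v = s • w}

variable {q} {S : Set (Env q)} {n : ℕ}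

theorem smul_mem_rad {s : Env q} (hs : s ∈ S) (v : P q n) : s • v ∈ rad q S n :=
  Submodule.subset_span ⟨s, hs, v, rfl⟩

theorem rad_induction {p : ∀ v : P q n, v ∈ rad q S n → Prop} (zero : p 0 (zero_mem _))
    (add : ∀ v w hv hw, p v hv → p w hw → p (v + w) (add_mem hv hw))
    (smul : ∀ s (hs : s ∈ S) w, p (s • w) (smul_mem_rad hs w)) {v : P q n} (hv : v ∈ rad q S n) :
    p v hv := by
  -- Quantifying over c replaces closure of the motive under scalars: on a generator s • w the
  -- scalar moves into w.
  have key : ∀ c : K, p (c • v) (Submodule.smul_mem _ c hv) := by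
    induction hv using Submodule.span_induction with
    | mem v h =>
      obtain ⟨s, hs, w, rfl⟩ := h
      intro c
      have := smul s hs (c • w)
      simpa only [smul_comm s c w] using this
    | zero => simpa only [smul_zero] using fun _ => zero
    | add v w _ _ hv hw =>
      intro c
      simpa only [smul_add] using add _ _ _ _ (hv c) (hw c)
    | smul b v _ hv =>
      intro c
      simpa only [smul_smul] using hv (c * b)
  simpa only [one_smul] using key 1

variable (hS : ∀ s ∈ S, ∀ t ∈ S, ∀ u ∈ S, s * t * u = 0)

include hS in
theorem smul_smul_eq_zero {s t : Env q} (hs : s ∈ S) (ht : t ∈ S) {v : P q n}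
    (hv : v ∈ rad q S n) : s • t • v = 0 := by
  induction hv using rad_induction with
  | zero => rw [smul_zero, smul_zero]
  | add v w _ _ hv hw => rw [smul_add, smul_add, hv, hw, add_zero]
  | smul u hu w => rw [← mul_smul, ← mul_smul, hS s hs t ht u hu, zero_smul]

include hS in
/-- The Nakayama lemma. -/
theorem eq_top_of_sup_rad (A : Submodule K (P q n)) (hA : ∀ s ∈ S, ∀ v ∈ A, s • v ∈ A)
    (h : A ⊔ rad q S n = ⊤) : A = ⊤ := by
  have hv (v : P q n) : ∃ x ∈ A, ∃ y ∈ rad q S n, x + y = v :=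
    Submodule.mem_sup.mp (h ▸ Submodule.mem_top)
  -- Modulo A every vector is a sum of S-multiples. Since triple products vanish, S²P lies in A,
  -- hence SP does, hence everything.
  have h2 : ∀ s ∈ S, ∀ t ∈ S, ∀ v : P q n, s • t • v ∈ A := fun s hs t ht v => by
    obtain ⟨x, hx, y, hy, rfl⟩ := hv v
    rw [smul_add, smul_add, smul_smul_eq_zero hS hs ht hy, add_zero]
    exact hA s hs _ (hA t ht x hx)
  have h1 : ∀ s ∈ S, ∀ v : P q n, s • v ∈ A := fun s hs v => by
    obtain ⟨x, hx, y, hy, rfl⟩ := hv v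
    rw [smul_add]
    refine add_mem (hA s hs x hx) ?_
    induction hy using rad_induction with
    | zero => rw [smul_zero]; exact zero_mem _
    | add v w _ _ hv hw => rw [smul_add]; exact add_mem hv hw
    | smul t ht w => exact h2 s hs t ht w
  have h0 : rad q S n ≤ A := fun v hv => by
    induction hv using rad_induction with
    | zero => exact zero_mem _
    | add v w _ _ hv hw => exact add_mem hv hw
    | smul t ht w => exact h1 t ht w
  rwa [sup_eq_left.mpr h0] at h

include hS in
theorem cube_eq_zero (N : P q n →+ P q n) (hN : ∀ v, N v ∈ rad q S n)
    (hs : ∀ s ∈ S, ∀ v, N (s • v) = s • N v) (v : P q n) : N (N (N v)) = 0 := by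
  -- Each application of N, which commutes with S, contributes one more factor from S; after three
  -- of them nothing is left.
  have h1 : ∀ s ∈ S, ∀ v ∈ rad q S n, s • N v = 0 := fun s hs' v hv => by
    induction hv using rad_induction with
    | zero => rw [map_zero, smul_zero]
    | add v w _ _ hv hw => rw [map_add, smul_add, hv, hw, add_zero]
    | smul t ht w => rw [hs t ht, smul_smul_eq_zero hS hs' ht (hN w)]
  have h2 : ∀ v ∈ rad q S n, N (N v) = 0 := fun v hv => by
    induction hv using rad_induction with
    | zero => rw [map_zero, map_zero]
    | add v w _ _ hv hw => rw [map_add, map_add, hv, hw, add_zero]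
    | smul t ht w => rw [hs t ht, hs t ht, h1 t ht _ (hN w)]
  exact h2 _ (hN v)

end Radical

/-- The left multiplications by arrows. -/
def leftArrows : Set (Env q) := {s | ∃ x, IsArrow q x ∧ s = lmul q x}

/-- The right multiplications by arrows. -/
def rightArrows : Set (Env q) := {s | ∃ x, IsArrow q x ∧ s = rmul q x}

theorem leftArrows_mul : ∀ s ∈ leftArrows q, ∀ t ∈ leftArrows q, ∀ u ∈ leftArrows q,
    s * t * u = 0 := by
  rintro _ ⟨x, hx, rfl⟩ _ ⟨y, hy, rfl⟩ _ ⟨z, hz, rfl⟩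
  rw [lmul_mul_lmul, lmul_mul_lmul, arrow_mul_arrow_mul_arrow q hx hy hz, lmul_zero]

theorem rightArrows_mul : ∀ s ∈ rightArrows q, ∀ t ∈ rightArrows q, ∀ u ∈ rightArrows q,
    s * t * u = 0 := by
  rintro _ ⟨x, hx, rfl⟩ _ ⟨y, hy, rfl⟩ _ ⟨z, hz, rfl⟩
  rw [rmul_mul_rmul, rmul_mul_rmul, ← mul_assoc, arrow_mul_arrow_mul_arrow q hz hy hx, rmul_zero]

theorem e_mul_arrow {x : Lam q} (hx : IsArrow q x) (i : ZMod m) :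
    e q i * x = x ∨ e q i * x = 0 := by
  obtain ⟨j, rfl | rfl⟩ := hx
  · rw [e_mul_a_eq]
    exact ite_eq_or_eq _ _ _
  · rw [e_mul_abar_eq]
    exact ite_eq_or_eq _ _ _

theorem arrow_mul_e {x : Lam q} (hx : IsArrow q x) (i : ZMod m) :
    x * e q i = x ∨ x * e q i = 0 := by
  obtain ⟨j, rfl | rfl⟩ := hx
  · rw [a_mul_e_eq]
    exact ite_eq_or_eq _ _ _
  · rw [abar_mul_e_eq]
    exact ite_eq_or_eq _ _ _

section

variable {q} {n : ℕ} {v : P q n}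

theorem lmul_arrow_smul_mem {x : Lam q} (hx : IsArrow q x) (v : P q n) :
    lmul q x • v ∈ rad q (leftArrows q) n := smul_mem_rad (S := leftArrows q) ⟨x, hx, rfl⟩ v

theorem rmul_arrow_smul_mem {x : Lam q} (hx : IsArrow q x) (v : P q n) :
    rmul q x • v ∈ rad q (rightArrows q) n := smul_mem_rad (S := rightArrows q) ⟨x, hx, rfl⟩ v

theorem rmul_soc_smul_mem (i : ZMod m) (v : P q n) :
    rmul q (soc q i) • v ∈ rad q (rightArrows q) n := by
  rw [soc, ← rmul_smul_rmul_smul]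
  exact rmul_arrow_smul_mem (isArrow_abar q i) _

/-- For a basis path y of positive length the product is in the radical whatever v is; for y = e_i
the arrow already present is either kept or killed. -/
theorem rmul_smul_mem_right (y : Lam q) (hv : v ∈ rad q (rightArrows q) n) :
    rmul q y • v ∈ rad q (rightArrows q) n := by
  induction y using lam_induction with
  | zero => rw [rmul_zero, zero_smul]; exact zero_mem _
  | add x y hx hy => rw [rmul_add, add_smul]; exact add_mem hx hy
  | smul c i y hy =>
    rw [rmul_smul, smul_assoc]
    refine Submodule.smul_mem _ c ?_
    cases hy with
    | e =>
      induction hv using rad_induction with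
      | zero => rw [smul_zero]; exact zero_mem _
      | add v w _ _ hv hw => rw [smul_add]; exact add_mem hv hw
      | smul t ht w =>
        obtain ⟨x, hx, rfl⟩ := ht
        rw [rmul_smul_rmul_smul]
        obtain h | h := arrow_mul_e q hx i
        · rw [h]; exact rmul_arrow_smul_mem hx w
        · rw [h, rmul_zero, zero_smul]; exact zero_mem _
    | a => exact rmul_arrow_smul_mem (isArrow_a q _) v
    | abar => exact rmul_arrow_smul_mem (isArrow_abar q _) v
    | soc => exact rmul_soc_smul_mem i v

theorem lmul_smul_mem_left (y : Lam q) (hv : v ∈ rad q (leftArrows q) n) :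
    lmul q y • v ∈ rad q (leftArrows q) n := by
  induction y using lam_induction with
  | zero => rw [lmul_zero, zero_smul]; exact zero_mem _
  | add x y hx hy => rw [lmul_add, add_smul]; exact add_mem hx hy
  | smul c i y hy =>
    rw [lmul_smul, smul_assoc]
    refine Submodule.smul_mem _ c ?_
    cases hy with
    | e =>
      induction hv using rad_induction with
      | zero => rw [smul_zero]; exact zero_mem _
      | add v w _ _ hv hw => rw [smul_add]; exact add_mem hv hw
      | smul t ht w =>
        obtain ⟨x, hx, rfl⟩ := ht
        rw [lmul_smul_lmul_smul]
        obtain h | h := e_mul_arrow q hx i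
        · rw [h]; exact lmul_arrow_smul_mem hx w
        · rw [h, lmul_zero, zero_smul]; exact zero_mem _
    | a => exact lmul_arrow_smul_mem (isArrow_a q _) v
    | abar => exact lmul_arrow_smul_mem (isArrow_abar q _) v
    | soc =>
      rw [soc, ← lmul_smul_lmul_smul]
      exact lmul_arrow_smul_mem (isArrow_a q i) _

theorem lmul_smul_mem_right (y : Lam q) (hv : v ∈ rad q (rightArrows q) n) :
    lmul q y • v ∈ rad q (rightArrows q) n := by
  induction hv using rad_induction with
  | zero => rw [smul_zero]; exact zero_mem _
  | add v w _ _ hv hw => rw [smul_add]; exact add_mem hv hw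
  | smul t ht w =>
    obtain ⟨x, hx, rfl⟩ := ht
    rw [lmul_smul_rmul_smul]
    exact rmul_arrow_smul_mem hx _

theorem rmul_smul_mem_left (y : Lam q) (hv : v ∈ rad q (leftArrows q) n) :
    rmul q y • v ∈ rad q (leftArrows q) n := by
  induction hv using rad_induction with
  | zero => rw [smul_zero]; exact zero_mem _
  | add v w _ _ hv hw => rw [smul_add]; exact add_mem hv hw
  | smul t ht w =>
    obtain ⟨x, hx, rfl⟩ := ht
    rw [← lmul_smul_rmul_smul]
    exact lmul_arrow_smul_mem hx _

end

/-! ### Minimality: images of the differential are superfluous -/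

theorem diff_mem_rad (k : ℕ) (v : P q (k + 1)) :
    diff q k v ∈ rad q (leftArrows q) k ⊔ rad q (rightArrows q) k := by
  induction v using gen_induction with
  | zero => rw [map_zero]; exact zero_mem _
  | add v w hv hw => rw [map_add]; exact add_mem hv hw
  | gen r i x y h0 h1 =>
    have hgen : diffGen q k r i ∈ rad q (leftArrows q) k ⊔ rad q (rightArrows q) k := by
      have hl {x : Lam q} (hx : IsArrow q x) (v : P q k) := Submodule.mem_sup_left
        (T := rad q (rightArrows q) k) (lmul_arrow_smul_mem hx v)
      have hr {x : Lam q} (hx : IsArrow q x) (v : P q k) := Submodule.mem_sup_right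
        (S := rad q (leftArrows q) k) (rmul_arrow_smul_mem hx v)
      rw [diffGen_eq q rfl]
      exact add_mem (add_mem (add_mem (hr (isArrow_a q _) _)
        (Submodule.smul_mem _ _ (hr (isArrow_abar q _) _)))
        (Submodule.smul_mem _ _ (hl (isArrow_a q _) _)))
        (Submodule.smul_mem _ _ (hl (isArrow_abar q _) _))
    rw [map_smul, map_smul, diff_gen_eq]
    obtain ⟨u, hu, w, hw, h⟩ := Submodule.mem_sup.mp hgen
    rw [← h, smul_add, smul_add]
    exact add_mem (Submodule.mem_sup_left (rmul_smul_mem_left y (lmul_smul_mem_left x hu)))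
      (Submodule.mem_sup_right (rmul_smul_mem_right y (lmul_smul_mem_right x hw)))

/-- Left and right arrows together do not have vanishing triple products, so the Nakayama lemma is
applied twice: first the right radical is removed, with the left radical joined to L, then the left
one. -/
theorem isSuperfluous_of_le {n : ℕ} (N : Submodule (Env q) (P q n))
    (hN : ∀ v ∈ N, v ∈ rad q (leftArrows q) n ⊔ rad q (rightArrows q) n) : IsSuperfluous N := by
  intro L hL
  have h1 : L.restrictScalars K ⊔ rad q (leftArrows q) n = ⊤ := by
    refine eq_top_of_sup_rad (rightArrows_mul q) _ ?_ ?_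
    · rintro _ ⟨x, hx, rfl⟩ v hv
      obtain ⟨u, hu, w, hw, rfl⟩ := Submodule.mem_sup.mp hv
      rw [smul_add]
      exact add_mem (Submodule.mem_sup_left (L.smul_mem _ hu))
        (Submodule.mem_sup_right (rmul_smul_mem_left x hw))
    · rw [sup_assoc, eq_top_iff]
      rintro v -
      obtain ⟨u, hu, w, hw, rfl⟩ := Submodule.mem_sup.mp (hL ▸ Submodule.mem_top : v ∈ N ⊔ L)
      exact add_mem (Submodule.mem_sup_right (hN u hu)) (Submodule.mem_sup_left hw)
  have h2 := eq_top_of_sup_rad (leftArrows_mul q) (L.restrictScalars K)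
    (fun s _ v hv => L.smul_mem s hv) h1
  rwa [Submodule.restrictScalars_eq_top_iff] at h2

/-! ### The homotopy and its values on basis paths -/

/-- The application of a linear functional to the left factor of the enveloping algebra. -/
def contract (φ : Lam q →ₗ[K] K) : Env q →ₗ[K] Lam q :=
  ((opLinearEquiv K).symm.toLinearMap ∘ₗ (TensorProduct.lid K (Lam q)ᵐᵒᵖ).toLinearMap ∘ₗ
    TensorProduct.map φ LinearMap.id : Lam q ⊗[K] (Lam q)ᵐᵒᵖ →ₗ[K] Lam q)

theorem contract_tens (φ : Lam q →ₗ[K] K) (x y : Lam q) :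
    contract q φ (tens q x y) = φ x • y := by
  change (opLinearEquiv K).symm (TensorProduct.lid K (Lam q)ᵐᵒᵖ
    (TensorProduct.map φ LinearMap.id (x ⊗ₜ[K] op y))) = φ x • y
  simp

/-- A coordinate function on `Λ_q`. -/
def coord (t : Fin 4) (k : ZMod m) : Lam q →ₗ[K] K :=
  LinearMap.proj k ∘ₗ (LinearMap.proj t : RegRep K m →ₗ[K] ZMod m → K) ∘ₗ coords q

theorem coord_apply (t : Fin 4) (k : ZMod m) (x : Lam q) : coord q t k x = coords q x t k := rfl

/-- The value of the contracting homotopy at `a_{i-1} ⊗_r e_{i+n-2r}`. -/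
def homotopyA (n : ℕ) (r : ℤ) (i : ZMod m) : P q (n + 1) :=
  if r = 0 then (-1 : K) ^ (n + 1) • gen q (n + 1) 0 (i - 1) else 0

/-- The value of the contracting homotopy at `ā_i ⊗_r e_{i+n-2r}`. -/
def homotopyAbar (n : ℕ) (r : ℤ) (i : ZMod m) : P q (n + 1) :=
  (-1 : K) ^ (n + r.toNat) • gen q (n + 1) (r + 1) (i + 1)

/-- The contracting homotopy on the summand belonging to `g^n_{r,i}`. -/
def homotopyAux (n : ℕ) (r : ℤ) (i : ZMod m) : Env q →+ P q (n + 1) where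
  toFun z := rmul q (contract q (coord q 1 (i - 1)) z) • homotopyA q n r i +
    rmul q (contract q (coord q 2 i) z) • homotopyAbar q n r i +
    rmul q (contract q (coord q 3 i) z) • lmul q (a q i) • homotopyAbar q n r i
  map_zero' := by simp [rmul_zero]
  map_add' z w := by
    simp only [map_add, rmul_add, add_smul]
    abel

theorem homotopyAux_tens (n : ℕ) (r : ℤ) (i : ZMod m) (x y : Lam q) :
    homotopyAux q n r i (tens q x y) =
      rmul q y • (coords q x 1 (i - 1) • homotopyA q n r i +
        coords q x 2 i • homotopyAbar q n r i +
        coords q x 3 i • lmul q (a q i) • homotopyAbar q n r i) := by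
  change rmul q (contract q (coord q 1 (i - 1)) (tens q x y)) • homotopyA q n r i +
    rmul q (contract q (coord q 2 i) (tens q x y)) • homotopyAbar q n r i +
    rmul q (contract q (coord q 3 i) (tens q x y)) • lmul q (a q i) • homotopyAbar q n r i = _
  simp only [contract_tens, coord_apply, rmul_smul, smul_assoc, smul_add,
    smul_comm (rmul q y) (_ : K)]

/-- The contracting homotopy of the complex `Λ_q / rad ⊗ P`, extended to a homomorphism of right
modules on `P`. -/
def homotopy (n : ℕ) : P q n →+ P q (n + 1) :=
  DirectSum.toAddMonoid (β := fun s : ZMod m × Fin (n + 1) =>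
    summand q s.1 (s.1 + n - 2 * (s.2 : ℕ))) fun s =>
      (homotopyAux q n (s.2 : ℕ) s.1).comp (Submodule.subtype _).toAddMonoidHom

theorem homotopy_smul_gen {n : ℕ} {r : ℤ} (h0 : 0 ≤ r) (h1 : r ≤ n) (i : ZMod m) (z : Env q) :
    homotopy q n (z • gen q n r i) = homotopyAux q n r i (z * idem q i (i + n - 2 * r)) := by
  obtain ⟨r, rfl⟩ := Int.eq_ofNat_of_zero_le h0
  rw [gen, dif_pos ⟨h0, h1⟩, ← map_smul]
  refine (DirectSum.toAddMonoid_of (β := fun s : ZMod m × Fin (n + 1) =>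
    summand q s.1 (s.1 + n - 2 * (s.2 : ℕ))) _ _ _).trans ?_
  simp

theorem homotopy_tens_gen {n : ℕ} {r : ℤ} (h0 : 0 ≤ r) (h1 : r ≤ n) (i : ZMod m) (x y : Lam q) :
    homotopy q n (rmul q y • lmul q x • gen q n r i) =
      rmul q (e q (i + n - 2 * r) * y) • (coords q (x * e q i) 1 (i - 1) • homotopyA q n r i +
        coords q (x * e q i) 2 i • homotopyAbar q n r i +
        coords q (x * e q i) 3 i • lmul q (a q i) • homotopyAbar q n r i) := by
  rw [← mul_smul, homotopy_smul_gen q h0 h1, rmul_mul_lmul, idem, tens_mul_tens, homotopyAux_tens]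

/-- The assigned value ends at the same vertex as its generator, which is what makes a right linear
extension agree with it in `homotopy_lmul_gen`. -/
theorem rmul_e_smul_homotopyA {n : ℕ} {r : ℤ} {i j : ZMod m} (hj : j = i + n - 2 * r) :
    rmul q (e q j) • homotopyA q n r i = homotopyA q n r i := by
  rw [homotopyA]
  split_ifs with h
  · rw [smul_comm, rmul_e_smul_gen]
    rw [hj, h]
    push_cast
    ring
  · rw [smul_zero]

theorem rmul_e_smul_homotopyAbar {n : ℕ} {r : ℤ} {i j : ZMod m} (hj : j = i + n - 2 * r) :
    rmul q (e q j) • homotopyAbar q n r i = homotopyAbar q n r i := by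
  rw [homotopyAbar, smul_comm, rmul_e_smul_gen]
  rw [hj]
  push_cast
  ring

theorem homotopy_lmul_gen {n : ℕ} {r : ℤ} (h0 : 0 ≤ r) (h1 : r ≤ n) (i : ZMod m) (x : Lam q) :
    homotopy q n (lmul q x • gen q n r i) =
      coords q (x * e q i) 1 (i - 1) • homotopyA q n r i +
        coords q (x * e q i) 2 i • homotopyAbar q n r i +
        coords q (x * e q i) 3 i • lmul q (a q i) • homotopyAbar q n r i := by
  have := homotopy_tens_gen q h0 h1 i x 1
  rw [rmul_one, one_smul, mul_one] at this
  rw [this]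
  simp only [smul_add, smul_comm (rmul q _) (_ : K), ← lmul_smul_rmul_smul,
    rmul_e_smul_homotopyA q rfl, rmul_e_smul_homotopyAbar q rfl]

theorem homotopy_rmul (n : ℕ) (y : Lam q) (v : P q n) :
    homotopy q n (rmul q y • v) = rmul q y • homotopy q n v := by
  induction v using gen_induction with
  | zero => rw [smul_zero, map_zero, smul_zero]
  | add v w hv hw => rw [smul_add, map_add, hv, hw, map_add, smul_add]
  | gen r i x z h0 h1 =>
    rw [rmul_smul_rmul_smul, homotopy_tens_gen q h0 h1, homotopy_tens_gen q h0 h1,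
      rmul_smul_rmul_smul, mul_assoc]

theorem homotopy_smul (n : ℕ) (c : K) (v : P q n) :
    homotopy q n (c • v) = c • homotopy q n v := by
  -- Scalars are right multiplications, so linearity over K is a case of right linearity.
  have h (k : ℕ) (v : P q k) : c • v = rmul q (c • 1) • v := by
    rw [rmul_smul, rmul_one, smul_assoc, one_smul]
  rw [h, homotopy_rmul, ← h]

section

variable {n : ℕ} {r : ℤ} (h0 : 0 ≤ r) (h1 : r ≤ n) (i : ZMod m)

include h0 h1

theorem homotopy_gen : homotopy q n (gen q n r i) = 0 := by
  rw [← lmul_e_smul_gen, homotopy_lmul_gen q h0 h1, e_mul_e, coords_e]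
  simp

theorem homotopy_a : homotopy q n (lmul q (a q (i - 1)) • gen q n r i) = homotopyA q n r i := by
  rw [homotopy_lmul_gen q h0 h1, a_mul_e q _ _ (by ring), coords_a]
  simp

theorem homotopy_abar :
    homotopy q n (lmul q (abar q i) • gen q n r i) = homotopyAbar q n r i := by
  rw [homotopy_lmul_gen q h0 h1, abar_mul_e, coords_abar]
  simp

theorem homotopy_soc : homotopy q n (lmul q (soc q i) • gen q n r i) =
    lmul q (a q i) • homotopyAbar q n r i := by
  rw [homotopy_lmul_gen q h0 h1, soc_mul_e, if_pos rfl, coords_soc]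
  simp

end

/-- The homotopy in degree `-1`. -/
def homotopyNeg : Lam q →+ P q 0 where
  toFun y := rmul q y • ∑ k, gen q 0 0 k
  map_zero' := by rw [rmul_zero, zero_smul]
  map_add' x y := by rw [rmul_add, add_smul]

theorem homotopyNeg_apply (y : Lam q) : homotopyNeg q y = rmul q y • ∑ k, gen q 0 0 k := rfl

/-! ### The homotopy identity modulo the right radical -/

/-- Reduction modulo the right radical. -/
def modRad (n : ℕ) : P q n →ₗ[K] P q n ⧸ rad q (rightArrows q) n := Submodule.mkQ _

theorem modRad_eq_zero {n : ℕ} {v : P q n} : modRad q n v = 0 ↔ v ∈ rad q (rightArrows q) n :=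
  Submodule.Quotient.mk_eq_zero _

theorem modRad_rmul_arrow {n : ℕ} {x : Lam q} (hx : IsArrow q x) (v : P q n) :
    modRad q n (rmul q x • v) = 0 :=
  (modRad_eq_zero q).mpr (rmul_arrow_smul_mem hx v)

/-- The coefficient of `a_i ⊗_r e_{i+n-2r}` in the differential, up to the sign `(-1)^{n+r}`. -/
def leftCoeff (r : ℤ) (i : ZMod m) : K := qprod q (i - r + 1) r

/-- The extra factor is the one in ā_i a_i = q_{i+1} a_{i+1} ā_{i+1}; this match gives the
cancellation in the ā case of `homotopy_succ`. -/
theorem leftCoeff_succ {r : ℤ} (hr : 0 ≤ r) (i : ZMod m) :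
    leftCoeff q (r + 1) (i + 1) = leftCoeff q r i * q (i + 1) := by
  rw [leftCoeff, leftCoeff, qprod_add_one q _ hr]
  congr 2
  · congr 1
    push_cast
    ring
  · congr 1
    push_cast
    ring

/-- Left and right actions commute, so the two terms with an arrow on the right die and only the
left differential survives. -/
theorem modRad_lmul_diffGen (k : ℕ) (r : ℤ) (i : ZMod m) (x : Lam q) :
    modRad q k (lmul q x • diffGen q k r i) =
      ((-1) ^ (k + 1 + r.toNat) * leftCoeff q r i) •
        modRad q k (lmul q (x * a q i) • gen q k r (i + 1)) +
      (-1 : K) ^ (k + 1 + r.toNat) •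
        modRad q k (lmul q (x * abar q (i - 1)) • gen q k (r - 1) (i - 1)) := by
  rw [diffGen_eq q rfl]
  simp only [smul_add, map_add, smul_comm (lmul q x) (_ : K), map_smul, lmul_smul_rmul_smul,
    modRad_rmul_arrow q (isArrow_a q _), modRad_rmul_arrow q (isArrow_abar q _), smul_zero,
    zero_add, lmul_smul_lmul_smul, pow_add, leftCoeff, mul_assoc]

theorem modRad_homotopy_lmul_diffGen (k : ℕ) (r : ℤ) (i : ZMod m) (x : Lam q) :
    modRad q (k + 1) (homotopy q k (lmul q x • diffGen q k r i)) =
      ((-1) ^ (k + 1 + r.toNat) * leftCoeff q r i) •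
        modRad q (k + 1) (homotopy q k (lmul q (x * a q i) • gen q k r (i + 1))) +
      (-1 : K) ^ (k + 1 + r.toNat) •
        modRad q (k + 1) (homotopy q k (lmul q (x * abar q (i - 1)) •
          gen q k (r - 1) (i - 1))) := by
  rw [diffGen_eq q rfl]
  simp only [smul_add, map_add, smul_comm (lmul q x) (_ : K), map_smul, lmul_smul_rmul_smul,
    homotopy_rmul, homotopy_smul,
    modRad_rmul_arrow q (isArrow_a q _), modRad_rmul_arrow q (isArrow_abar q _), smul_zero,
    zero_add, lmul_smul_lmul_smul, pow_add, leftCoeff, mul_assoc]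

theorem neg_one_pow_mul_self (n : ℕ) : ((-1 : K)) ^ n * (-1) ^ n = 1 := by
  rw [← mul_pow]
  simp

theorem modRad_diff_homotopyA (n : ℕ) (i : ZMod m) :
    modRad q n (diff q n (homotopyA q n 0 i)) =
      modRad q n (lmul q (a q (i - 1)) • gen q n 0 i) := by
  rw [homotopyA, if_pos rfl, map_smul_env, map_smul, diff_gen_eq,
    ← one_smul (Env q) (diffGen q n 0 (i - 1)), ← lmul_one, modRad_lmul_diffGen,
    gen_eq_zero q n (0 - 1) _ (by omega), leftCoeff, qprod_of_nonpos q _ le_rfl]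
  simp [smul_smul, neg_one_pow_mul_self]

theorem modRad_lmul_diff_homotopyAbar (n : ℕ) {r : ℤ} (hr : 0 ≤ r) (i : ZMod m) (x : Lam q) :
    modRad q n (lmul q x • diff q n (homotopyAbar q n r i)) =
      leftCoeff q (r + 1) (i + 1) •
        modRad q n (lmul q (x * a q (i + 1)) • gen q n (r + 1) (i + 2)) +
      modRad q n (lmul q (x * abar q i) • gen q n r i) := by
  rw [homotopyAbar, map_smul_env, smul_comm, map_smul, diff_gen_eq, modRad_lmul_diffGen,
    show (r + 1).toNat = r.toNat + 1 by omega, show n + 1 + (r.toNat + 1) = n + r.toNat + 2 by ring,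
    pow_add _ _ 2, neg_one_sq, mul_one, smul_add, smul_smul, smul_smul, ← mul_assoc,
    neg_one_pow_mul_self, one_mul, one_smul, add_sub_cancel_right, add_sub_cancel_right,
    show i + 1 + 1 = i + 2 by ring]

theorem modRad_diff_homotopyAbar (n : ℕ) {r : ℤ} (hr : 0 ≤ r) (i : ZMod m) :
    modRad q n (diff q n (homotopyAbar q n r i)) =
      leftCoeff q (r + 1) (i + 1) •
        modRad q n (lmul q (a q (i + 1)) • gen q n (r + 1) (i + 2)) +
      modRad q n (lmul q (abar q i) • gen q n r i) := by
  have := modRad_lmul_diff_homotopyAbar q n hr i 1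
  rwa [lmul_one, one_smul, one_mul, one_mul] at this

/-- Multiplying the ā case on the left by a_i kills its unwanted term, because a_i a_{i+1} = 0. -/
theorem modRad_diff_homotopy_soc (n : ℕ) {r : ℤ} (hr : 0 ≤ r) (i : ZMod m) :
    modRad q n (diff q n (lmul q (a q i) • homotopyAbar q n r i)) =
      modRad q n (lmul q (soc q i) • gen q n r i) := by
  rw [map_smul, modRad_lmul_diff_homotopyAbar q n hr, a_mul_a, lmul_zero, zero_smul, map_zero,
    smul_zero, zero_add, soc]

/-- All maps are right linear, so only x ⊗_r e with x a basis path matters. For the upper member of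
a pair (e, or a with r ≥ 1) the summand h∂ reproduces it; for the lower member (ā, the socle, or a
with r = 0) the summand ∂h does. -/
theorem homotopy_succ (n : ℕ) (v : P q (n + 1)) :
    diff q (n + 1) (homotopy q (n + 1) v) + homotopy q n (diff q n v) - v ∈
      rad q (rightArrows q) (n + 1) := by
  induction v using basisPath_induction with
  | zero => simp
  | add v w hv hw =>
    simp only [map_add]
    convert add_mem hv hw using 1
    abel
  | gen r i x y h0 h1 hx =>
    rw [map_smul (diff q n), homotopy_rmul, homotopy_rmul, map_smul (diff q (n + 1)), ← smul_add,
      ← smul_sub]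
    refine rmul_smul_mem_right y ?_
    rw [← modRad_eq_zero, map_sub, map_add, map_smul (diff q n), diff_gen_eq,
      modRad_homotopy_lmul_diffGen]
    have hr : r = 0 ∨ 1 ≤ r := by omega
    have h1' : r ≤ n ∨ r = n + 1 := by push_cast at h1; omega
    cases hx with
    | e =>
      rw [lmul_e_smul_gen, homotopy_gen q h0 h1, map_zero, map_zero, e_mul_a]
      obtain rfl | hr := hr
      · have := homotopy_a q (n := n) le_rfl (by omega) (i + 1)
        rw [add_sub_cancel_right] at this
        rw [this, gen_eq_zero q n (0 - 1) _ (by omega), smul_zero, map_zero, map_zero, smul_zero,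
          homotopyA, if_pos rfl, map_smul, smul_smul, add_sub_cancel_right, leftCoeff,
          qprod_of_nonpos q _ le_rfl, mul_one, Int.toNat_zero, add_zero, add_zero,
          neg_one_pow_mul_self, one_smul, zero_add, sub_self]
      · have hA : homotopy q n (lmul q (a q i) • gen q n r (i + 1)) = 0 := by
          obtain h | h := h1'
          · have := homotopy_a q h0 h (i + 1)
            rwa [add_sub_cancel_right, homotopyA, if_neg (by omega)] at this
          · rw [gen_eq_zero q n r _ (by omega), smul_zero, map_zero]
        rw [hA, e_mul_abar q _ _ (by ring), homotopy_abar q (by omega) (by push_cast at h1; omega),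
          homotopyAbar, map_smul, smul_smul, sub_add_cancel, sub_add_cancel,
          show n + 1 + r.toNat = n + (r - 1).toNat + 2 by omega, pow_add _ _ 2, neg_one_sq,
          mul_one, neg_one_pow_mul_self]
        simp
    | a =>
      rw [homotopy_a q h0 h1, a_mul_a, a_mul_abar, if_pos rfl, lmul_zero, zero_smul, map_zero,
        map_zero, smul_zero, zero_add]
      obtain rfl | hr := hr
      · rw [modRad_diff_homotopyA, gen_eq_zero q n (0 - 1) _ (by omega)]
        simp
      · rw [homotopyA, if_neg (by omega), homotopy_soc q (by omega) (by push_cast at h1; omega),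
          homotopyAbar, smul_comm, map_smul, smul_smul, sub_add_cancel, sub_add_cancel,
          show n + 1 + r.toNat = n + (r - 1).toNat + 2 by omega, pow_add _ _ 2, neg_one_sq,
          mul_one, neg_one_pow_mul_self]
        simp
    | abar =>
      rw [homotopy_abar q h0 h1, modRad_diff_homotopyAbar q _ h0, abar_mul_abar, abar_mul_a,
        if_pos rfl, lmul_zero, zero_smul, map_zero, map_zero, smul_zero, add_zero]
      obtain h | h := h1'
      -- Here ∂h leaves an extra multiple of a_{i+1} ⊗_{r+1} e, and h∂, through ā_i a_i = q_{i+1}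
      -- a_{i+1} ā_{i+1}, gives its negative. For r = n + 1 both are absent.
      · rw [lmul_smul, smul_assoc, homotopy_smul, homotopy_soc q h0 h, homotopyAbar,
          leftCoeff_succ q h0, smul_comm (lmul q _) (_ : K), (modRad q (n + 1)).map_smul,
          (modRad q (n + 1)).map_smul,
          show i + 1 + 1 = i + 2 by ring, show n + 1 + r.toNat = n + r.toNat + 1 by ring]
        have := neg_one_pow_mul_self (K := K) (n + r.toNat)
        match_scalars
        · linear_combination (-(leftCoeff q r i * q (i + 1))) * this
        · ring
      · rw [gen_eq_zero q n r _ (by omega), gen_eq_zero q (n + 1) (r + 1) _ (by omega)]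
        simp
    | soc =>
      rw [homotopy_soc q h0 h1, modRad_diff_homotopy_soc q _ h0, soc_mul_a, soc_mul_abar]
      simp [lmul_zero]

theorem homotopyNeg_rmul (x y : Lam q) :
    homotopyNeg q (rmul q y • x) = rmul q y • homotopyNeg q x := by
  rw [homotopyNeg_apply, homotopyNeg_apply, rmul_smul_rmul_smul, rmul_smul_lam]

theorem homotopyNeg_arrow {x : Lam q} (hx : IsArrow q x) :
    modRad q 0 (homotopyNeg q x) = 0 :=
  modRad_rmul_arrow q hx _

theorem homotopyNeg_e (i : ZMod m) : homotopyNeg q (e q i) = gen q 0 0 i := by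
  have h (k : ZMod m) : rmul q (e q i) • gen q 0 0 k = if k = i then gen q 0 0 i else 0 := by
    rw [← rmul_e_smul_gen q (n := 0) (r := 0) (i := k) (j := k) (by simp), rmul_smul_rmul_smul,
      e_mul_e_eq]
    split_ifs with h
    · rw [h, rmul_e_smul_gen q (by simp)]
    · rw [rmul_zero, zero_smul]
  rw [homotopyNeg_apply, Finset.smul_sum]
  simp [h]

/-- In degree 0 the unpaired e_i ⊗_0 e_i is recovered through `homotopyNeg`, which sends paths of
positive length into the right radical. -/
theorem homotopy_zero (v : P q 0) :
    diff q 0 (homotopy q 0 v) + homotopyNeg q (aug q v) - v ∈ rad q (rightArrows q) 0 := by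
  induction v using basisPath_induction with
  | zero => simp
  | add v w hv hw =>
    simp only [map_add]
    convert add_mem hv hw using 1
    abel
  | gen r i x y h0 h1 hx =>
    rw [map_smul (aug q), homotopy_rmul, homotopyNeg_rmul, map_smul (diff q 0), ← smul_add,
      ← smul_sub]
    refine rmul_smul_mem_right y ?_
    obtain rfl : r = 0 := by omega
    rw [← modRad_eq_zero, map_sub, map_add, map_smul (aug q), aug_gen, lmul_smul_lam]
    cases hx with
    | e =>
      rw [lmul_e_smul_gen, homotopy_gen q h0 h1, e_mul_e, homotopyNeg_e]
      simp
    | a =>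
      rw [homotopy_a q h0 h1, a_mul_e q _ _ (by ring), homotopyNeg_arrow q (isArrow_a q _),
        modRad_diff_homotopyA, add_zero, sub_self]
    | abar =>
      rw [homotopy_abar q h0 h1, abar_mul_e, homotopyNeg_arrow q (isArrow_abar q _),
        modRad_diff_homotopyAbar q _ h0, gen_eq_zero q 0 (0 + 1) _ (by omega)]
      simp
    | soc =>
      rw [homotopy_soc q h0 h1, soc_mul_e, if_pos rfl, homotopyNeg_apply,
        (modRad_eq_zero q).mpr (rmul_soc_smul_mem i _), modRad_diff_homotopy_soc q _ h0, add_zero,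
        sub_self]

/-! ### Exactness and the conclusion -/

/-- A complex is exact if it has a homotopy between the identity and an endomorphism with
vanishing cube. -/
theorem exact_of_cube_eq_zero {A B C : Type*} [AddCommGroup A] [AddCommGroup B] [AddCommGroup C]
    (f : A →+ B) (g : B →+ C) (h : B →+ A) (h' : C →+ B) (hgf : ∀ x, g (f x) = 0)
    (N : B →+ B) (hN : ∀ x, N x = f (h x) + h' (g x) - x) (hN3 : ∀ x, N (N (N x)) = 0) :
    Function.Exact f g := by
  have hf {x : B} (hx : g x = 0) : N x = f (h x) - x := by rw [hN, hx, map_zero, add_zero]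
  have hg {x : B} (hx : g x = 0) : g (N x) = 0 := by rw [hf hx, map_sub, hgf, hx, sub_zero]
  refine fun x => ⟨fun hx => ?_, ?_⟩
  -- On the kernel of g, which N preserves, N = fh - 1; hence x = fh(x) - N x, and iterating this
  -- stops after three terms because N³ = 0.
  · refine ⟨h x - h (N x) + h (N (N x)), ?_⟩
    have h1 := hf hx
    have h2 := hf (hg hx)
    have h3 := hf (hg (hg hx))
    rw [hN3] at h3
    rw [map_add, map_sub, sub_eq_iff_eq_add.mp h1.symm, sub_eq_iff_eq_add.mp h2.symm,
      sub_eq_iff_eq_add.mp h3.symm]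
    abel
  · rintro ⟨y, rfl⟩
    exact hgf y

theorem exact_diff_aug : Function.Exact (diff q 0) (aug q) :=
  exact_of_cube_eq_zero (diff q 0).toAddMonoidHom (aug q).toAddMonoidHom (homotopy q 0)
    (homotopyNeg q) (fun x => LinearMap.congr_fun (aug_comp_diff q) x)
    ((diff q 0).toAddMonoidHom.comp (homotopy q 0) +
      (homotopyNeg q).comp (aug q).toAddMonoidHom - AddMonoidHom.id _) (fun _ => rfl)
    (cube_eq_zero (rightArrows_mul q) _ (homotopy_zero q) (by
      rintro _ ⟨y, -, rfl⟩ v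
      change diff q 0 (homotopy q 0 (rmul q y • v)) + homotopyNeg q (aug q (rmul q y • v)) -
        rmul q y • v = rmul q y • (diff q 0 (homotopy q 0 v) + homotopyNeg q (aug q v) - v)
      rw [map_smul (aug q), homotopy_rmul, homotopyNeg_rmul, map_smul (diff q 0), smul_sub,
        smul_add]))

theorem exact_diff_diff (n : ℕ) : Function.Exact (diff q (n + 1)) (diff q n) :=
  exact_of_cube_eq_zero (diff q (n + 1)).toAddMonoidHom (diff q n).toAddMonoidHom
    (homotopy q (n + 1)) (homotopy q n) (fun x => LinearMap.congr_fun (diff_comp_diff q n) x)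
    ((diff q (n + 1)).toAddMonoidHom.comp (homotopy q (n + 1)) +
      (homotopy q n).comp (diff q n).toAddMonoidHom - AddMonoidHom.id _) (fun _ => rfl)
    (cube_eq_zero (rightArrows_mul q) _ (homotopy_succ q n) (by
      rintro _ ⟨y, -, rfl⟩ v
      change diff q (n + 1) (homotopy q (n + 1) (rmul q y • v)) +
        homotopy q n (diff q n (rmul q y • v)) - rmul q y • v =
          rmul q y • (diff q (n + 1) (homotopy q (n + 1) v) + homotopy q n (diff q n v) - v)
      rw [map_smul (diff q n), homotopy_rmul, homotopy_rmul, map_smul (diff q (n + 1)), smul_sub,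
        smul_add]))

theorem isMinimalProjectiveResolution : IsMinimalProjectiveResolution (diff q) (aug q) where
  projective := projective_P q
  surjective := aug_surjective q
  exact_zero := exact_diff_aug q
  exact_succ := exact_diff_diff q
  minimal_zero := isSuperfluous_of_le q _ fun v hv => by
    obtain ⟨w, rfl⟩ := (exact_diff_aug q v).mp hv
    exact diff_mem_rad q 0 w
  minimal_succ n := isSuperfluous_of_le q _ fun v hv => by
    obtain ⟨w, rfl⟩ := (exact_diff_diff q n v).mp hv
    exact diff_mem_rad q (n + 1) w

end DeformedCycle

end

theorem mainTheorem1 {K : Type*} [Field K] (m : ℕ) [NeZero m] (q : ZMod m → Kˣ) :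
    (∀ (n : ℕ) (r : ℤ) (i : ZMod m), 0 ≤ r → r ≤ n →
      (DeformedCycle.g q n r i).IsUniform i (i + n - 2 * r)) ∧
    (∀ (n : ℕ) (r : ℤ) (i : ZMod m), 0 ≤ r → r ≤ n + 1 →
      DeformedCycle.g q (n + 1) r i =
        ((-1) ^ r.toNat * DeformedCycle.qprod q (i - r + 1) r) •
            (DeformedCycle.pathA K i * DeformedCycle.g q n r (i + 1)) +
          ((-1 : K) ^ r.toNat) •
            (DeformedCycle.pathAbar K (i - 1) * DeformedCycle.g q n (r - 1) (i - 1))) ∧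
    IsMinimalProjectiveResolution (DeformedCycle.diff q) (DeformedCycle.aug q) :=
  ⟨DeformedCycle.isUniform_g q, fun n r i _ _ => DeformedCycle.g_succ_left q n r i,
    DeformedCycle.isMinimalProjectiveResolution q⟩
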